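/- Let $d\ge 1$, $0<\vartheta_1<\dots<\vartheta_d$, and let $k(y\mid\theta)=e^{-\theta}\theta^y/y!$ be the Poisson kernel. For a probability mass function $g$ on $\{\vartheta_1,\dots,\vartheta_d\}$ put $p_g(y)=\sum_{j=1}^d k(y\mid\vartheta_j)g(\vartheta_j)$ and $\hat\theta_g(y)=(y+1)\,p_g(y+1)/p_g(y)$ for $y\in\mathbb N_0$, and $$W_g(y)=\hat\theta_g(y)^2\,E_{Z\sim p_g}\Bigl[\Bigl(\sum_{j=1}^d\frac{k(Z\mid\vartheta_j)g(\vartheta_j)}{p_g(Z)}\Bigl(\frac{k(y+1\mid\vartheta_j)}{p_g(y+1)}-\frac{k(y\mid\vartheta_j)}{p_g(y)}\Bigr)\Bigr)^2\Bigr].$$ Let $(Y_n)_{n\ge1}$ be $\mathbb N_0$-valued random variables on a probability space $(\Omega,\mathcal F,\mathbb P)$ with natural filtration $\mathcal G_n=\sigma(Y_1,\dots,Y_n)$, $n\ge0$, let $g_0$ be a probability mass function on $\{\vartheta_1,\dots,\vartheta_d\}$, and let $\alpha_n\in(0,1)$ satisfy $\sum_{n\ge1}\alpha_n=\infty$ and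 $\sum_{n\ge1}\alpha_n^2<\infty$. Suppose that, for all $n\ge0$ and $y\in\mathbb N_0$, $\mathbb P(Y_{n+1}=y\mid\mathcal G_n)=p_{g_n}(y)$ almost surely, where $$g_{n+1}(\vartheta_j)=(1-\alpha_{n+1})g_n(\vartheta_j)+\alpha_{n+1}\frac{k(Y_{n+1}\mid\vartheta_j)g_n(\vartheta_j)}{p_{g_n}(Y_{n+1})},\qquad j=1,\dots,d.$$ Assume that $(\alpha_n)_{n\ge1}$ is non-increasing and that $\sum_{n\ge1}\bigl(\alpha_n^2/\sum_{k\ge n}\alpha_k^2\bigr)^2<\infty$, and let $b_n=(\sum_{k\ge n}\alpha_k^2)^{-1}$. Then $g_n$ converges $\mathbb P$-almost surely to a random probability mass function $\tilde g$ on $\{\vartheta_1,\dots,\vartheta_d\}$, and for every $y\in\mathbb N_0$: 1. for $\mathbb P$-almost every $\omega$, the (regular) conditional distribution of $b_n^{1/2}(\hat\theta_{\tilde g}(y)-\hat\theta_{g_n}(y))$ given $\mathcal G_n$ converges weakly, as $n\to\infty$, to the centered Gaussian kernel with random variance $W_{\tilde g}(y)$ (the Gaussian law with variance $0$ being the point mass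 at $0$); 2. $W_{g_n}(y)\to W_{\tilde g}(y)$ $\mathbb P$-almost surely; 3. (asymptotic credible intervals) for every $z>0$, $\mathbb P$-almost surely on $\{W_{\tilde g}(y)>0\}$, $$\mathbb P\Bigl(\bigl|\hat\theta_{\tilde g}(y)-\hat\theta_{g_n}(y)\bigr|\le z\sqrt{W_{g_n}(y)/b_n}\;\Big|\;\mathcal G_n\Bigr)\longrightarrow \mathbb P(|N|\le z),\qquad N\sim\mathcal N(0,1).$$ -/

import Mathlib

open MeasureTheory ProbabilityTheory Filter Topology

namespace QuasiBayes

noncomputable section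

/-! The Poisson mixture model on a finite grid and the induced estimator. -/

/-- The Poisson probability `k(y ∣ θ) = e^{-θ} θ^y / y!`. -/
def pois (y : ℕ) (θ : ℝ) : ℝ := Real.exp (-θ) * θ ^ y / (y.factorial : ℝ)

/-- The mixture `p_g(y) = ∑ j, k(y ∣ ϑ_j) g(ϑ_j)`; a weight function `g` on the grid
`{ϑ_1, …, ϑ_d}` is represented by the vector of its values. -/
def mixture {d : ℕ} (ϑ : Fin d → ℝ) (g : Fin d → ℝ) (y : ℕ) : ℝ :=
  ∑ j, pois y (ϑ j) * g j

/-- The posterior weights `k(z ∣ ϑ_j) g(ϑ_j) / p_g(z)`. -/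
def postWeight {d : ℕ} (ϑ : Fin d → ℝ) (g : Fin d → ℝ) (z : ℕ) (j : Fin d) : ℝ :=
  pois z (ϑ j) * g j / mixture ϑ g z

/-- Newton's recursion driven by the observations `y 1, y 2, …`
(the values `y 0` and `α 0` are never used). -/
def newton {d : ℕ} (ϑ : Fin d → ℝ) (α : ℕ → ℝ) (g₀ : Fin d → ℝ) (y : ℕ → ℕ) :
    ℕ → Fin d → ℝ
  | 0 => g₀
  | n + 1 => fun j =>
      (1 - α (n + 1)) * newton ϑ α g₀ y n j
        + α (n + 1) * postWeight ϑ (newton ϑ α g₀ y n) (y (n + 1)) j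

/-- The estimator `(y + 1) p_g(y + 1) / p_g(y)`. -/
def estimate {d : ℕ} (ϑ : Fin d → ℝ) (g : Fin d → ℝ) (y : ℕ) : ℝ :=
  ((y : ℝ) + 1) * mixture ϑ g (y + 1) / mixture ϑ g y

/-- The inner sum of the asymptotic variance, as a function of `z`. -/
def score {d : ℕ} (ϑ : Fin d → ℝ) (g : Fin d → ℝ) (y z : ℕ) : ℝ :=
  ∑ j, postWeight ϑ g z j *
    (pois (y + 1) (ϑ j) / mixture ϑ g (y + 1) - pois y (ϑ j) / mixture ϑ g y)

/-- The asymptotic variance `W_g(y)`: the squared estimator times the expectation of the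
squared score at `Z`, where `Z` has probability mass function `p_g`. -/
def asympVar {d : ℕ} (ϑ : Fin d → ℝ) (g : Fin d → ℝ) (y : ℕ) : ℝ :=
  estimate ϑ g y ^ 2 * ∑' z : ℕ, mixture ϑ g z * score ϑ g y z ^ 2

lemma pois_pos {θ : ℝ} (hθ : 0 < θ) (y : ℕ) : 0 < pois y θ := by
  unfold pois; positivity

lemma summable_pois (θ : ℝ) : Summable fun y : ℕ => pois y θ := by
  simpa [pois, mul_div_assoc] using (Real.summable_pow_div_factorial θ).mul_left (Real.exp (-θ))

/-- The expectation in `asympVar` is that of a summable series. -/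
lemma summable_score {d : ℕ} {ϑ : Fin d → ℝ} (hϑ : ∀ j, 0 < ϑ j) {g : Fin d → ℝ}
    (hg : g ∈ stdSimplex ℝ (Fin d)) (y : ℕ) :
    Summable fun z : ℕ => mixture ϑ g z * score ϑ g y z ^ 2 := by
  have hm : ∀ z, 0 ≤ mixture ϑ g z := fun z =>
    Finset.sum_nonneg fun j _ => mul_nonneg (pois_pos (hϑ j) z).le (hg.1 j)
  have hs : Summable fun z : ℕ => mixture ϑ g z := by
    unfold mixture
    exact summable_sum fun j _ => (summable_pois (ϑ j)).mul_right (g j)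
  set c : Fin d → ℝ := fun j =>
    pois (y + 1) (ϑ j) / mixture ϑ g (y + 1) - pois y (ϑ j) / mixture ϑ g y with hc
  refine Summable.of_nonneg_of_le (fun z => mul_nonneg (hm z) (sq_nonneg _)) (fun z => ?_)
    (hs.mul_right ((∑ j, |c j|) ^ 2))
  refine mul_le_mul_of_nonneg_left (sq_le_sq' ?_ ?_ ) (hm z)
  all_goals
    have h : |score ϑ g y z| ≤ ∑ j, |c j| := by
      refine (Finset.abs_sum_le_sum_abs _ _).trans (Finset.sum_le_sum fun j _ => ?_)
      rw [abs_mul]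
      refine mul_le_of_le_one_left (abs_nonneg _) ?_
      have h0 : 0 ≤ pois z (ϑ j) * g j := mul_nonneg (pois_pos (hϑ j) z).le (hg.1 j)
      rw [postWeight, abs_of_nonneg (div_nonneg h0 (hm z))]
      refine div_le_one_of_le₀ ?_ (hm z)
      exact Finset.single_le_sum (f := fun j => pois z (ϑ j) * g j)
        (fun i _ => mul_nonneg (pois_pos (hϑ i) z).le (hg.1 i)) (Finset.mem_univ j)
    linarith [abs_le.1 h]

/-! The learning model. -/

variable {Ω : Type*}

/-- The σ-algebra `𝒢_n` generated by `Y_1, …, Y_n` (trivial for `n = 0`). -/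
@[reducible] def observed (Y : ℕ → Ω → ℕ) (n : ℕ) : MeasurableSpace Ω :=
  ⨆ k ∈ Finset.Icc 1 n, MeasurableSpace.comap (Y k) ⊤

/-- The random weight vector `g_n`. -/
def newtonProcess {d : ℕ} (ϑ : Fin d → ℝ) (α : ℕ → ℝ) (g₀ : Fin d → ℝ) (Y : ℕ → Ω → ℕ)
    (n : ℕ) (ω : Ω) : Fin d → ℝ :=
  newton ϑ α g₀ (fun k => Y k ω) n

variable [mΩ : MeasurableSpace Ω]

/-- The process `(Y_n)_{n ≥ 1}` follows the learning model with grid `ϑ`, learning rate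
`(α_n)_{n ≥ 1}` and initial guess `g₀`: conditionally on `Y_1, …, Y_n`, the next observation
has probability mass function `p_{g_n}`. -/
structure LearningModel {d : ℕ} (P : Measure Ω) (ϑ : Fin d → ℝ) (α : ℕ → ℝ)
    (g₀ : Fin d → ℝ) (Y : ℕ → Ω → ℕ) : Prop where
  grid_pos : ∀ j, 0 < ϑ j
  grid_strictMono : StrictMono ϑ
  initial_mem : g₀ ∈ stdSimplex ℝ (Fin d)
  rate_mem : ∀ n, 1 ≤ n → α n ∈ Set.Ioo (0 : ℝ) 1
  rate_diverges : Tendsto (fun N => ∑ n ∈ Finset.Icc 1 N, α n) atTop atTop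
  rate_sq_summable : Summable fun n : ℕ => α (n + 1) ^ 2
  measurable : ∀ n, 1 ≤ n → Measurable (Y n)
  predictive : ∀ n y, P⟦Y (n + 1) ⁻¹' {y} | observed Y n⟧
    =ᵐ[P] fun ω => mixture ϑ (newtonProcess ϑ α g₀ Y n ω) y

/-- `gt` is a random probability mass function on the grid and the almost sure limit
of the random weights `g n`. -/
structure IsRandomLimit {d : ℕ} (P : Measure Ω) (g : ℕ → Ω → Fin d → ℝ)
    (gt : Ω → Fin d → ℝ) : Prop where
  measurable : Measurable gt
  mem_simplex : ∀ ω, gt ω ∈ stdSimplex ℝ (Fin d)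
  tendsto : ∀ᵐ ω ∂P, Tendsto (fun n => g n ω) atTop (𝓝 (gt ω))

/-! Almost sure conditional convergence. -/

/-- A regular version of the conditional distribution of `X` given the sub-σ-algebra `m`,
that is, the regular conditional distribution of `X` given the identity map from `Ω` to the
measurable space `(Ω, m)`. -/
def condLaw {Ω : Type*} (m : MeasurableSpace Ω) {mΩ : MeasurableSpace Ω} (P : Measure Ω)
    [IsFiniteMeasure P] (X : Ω → ℝ) : @Kernel Ω ℝ m _ :=
  @condDistrib Ω Ω ℝ _ _ _ mΩ m X id P _

instance isProbabilityMeasure_condLaw {Ω : Type*} (m : MeasurableSpace Ω)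
    {mΩ : MeasurableSpace Ω} (P : Measure Ω) [IsFiniteMeasure P] (X : Ω → ℝ) (ω : Ω) :
    IsProbabilityMeasure (condLaw m P X ω) := by
  have h : @IsMarkovKernel Ω ℝ m _ (condLaw m P X) := by
    unfold condLaw; infer_instance
  exact h.isProbabilityMeasure ω

/-- For almost every `ω`, the conditional distribution of `X n` given `𝒢 n` at `ω` converges
weakly to `κ ω`. -/
def ConvergesCondAS (P : Measure Ω) [IsFiniteMeasure P] (𝒢 : ℕ → MeasurableSpace Ω)
    (X : ℕ → Ω → ℝ) (κ : Kernel Ω ℝ) [IsMarkovKernel κ] : Prop :=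
  ∀ᵐ ω ∂P, Tendsto (β := ProbabilityMeasure ℝ)
    (fun n => ⟨condLaw (𝒢 n) P (X n) ω, isProbabilityMeasure_condLaw (𝒢 n) P (X n) ω⟩)
    atTop (nhds (X := ProbabilityMeasure ℝ) ⟨κ ω, IsMarkovKernel.isProbabilityMeasure ω⟩)

/-- `κ` is the centered Gaussian kernel with random variance `W`
(the Gaussian law with variance zero is the point mass at zero). -/
def IsCenteredGaussianKernel (κ : Kernel Ω ℝ) (W : Ω → ℝ) : Prop :=
  Measurable W ∧ ∀ ω, 0 ≤ W ω ∧ κ ω = gaussianReal 0 (W ω).toNNReal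

/-! The rate. -/

/-- The tail sum `∑_{k ≥ n} α_k²`. -/
def tailSq (α : ℕ → ℝ) (n : ℕ) : ℝ := ∑' k : ℕ, α (n + k) ^ 2

/-- The rate `b_n = (∑_{k ≥ n} α_k²)⁻¹`. -/
def rate (α : ℕ → ℝ) (n : ℕ) : ℝ := (tailSq α n)⁻¹

end

end QuasiBayes

open QuasiBayes

/-!
The weights `g_n` are a bounded martingale: averaging the posterior weights over the predictive
distribution returns the prior weights (`hasSum_mixture_mul_postWeight`). Hence they converge
almost surely. For the central limit theorem, everything reduces to one bound that is uniform over
the past and therefore needs no further almost sure argument.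

Fix `n` and let `u` be the gradient of the estimator at `g_n`. The estimator is a quotient of linear
functions, so its error `θ̂_{g̃} - θ̂_{g_n}` is `⟨u, g̃ - g_n⟩` up to a remainder quadratic in
`g̃ - g_n` (`exists_abs_estimate_remainder_le`), whose conditional mean is of order `1 / b_n` by
orthogonality of the martingale increments. The linear part is a martingale from time `n` on, with
increments of order `α_k` and conditional variances `α_k² V_u(g_{k-1})`, where `V_u(g)` is the
variance of one Bayesian update of `g` along `u` (`dirVar`). Since `V_u` is Lipschitz in `g`
(`abs_dirVar_sub_le`) and `V_u(g_n) = W_{g_n}(y)` (`dirVar_estimateGrad`), the telescoping argument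
of Lindeberg, carried out for characteristic functions on an arbitrary event of the past
(`norm_integral_exp_martingale_sub_le`), shows that, on average over any event of the past, the
characteristic function of `b_n^{1/2} (θ̂_{g̃} - θ̂_{g_n})` differs from `exp (-t² W_{g_n} / 2)` by at
most a deterministic `ε_n(t)`, continuous in `t` (`LearningModel.exists_charFun_error`). It tends to
zero because `b_n α_n² → 0` and because the rates are non-increasing, so that `b_n α_k² ≤ b_n α_n²` for
all `k ≥ n`.

As `W` is continuous on the simplex, `W_{g_n} → W_{g̃}`, and Lévy's theorem gives the conditional
convergence. The credible intervals follow from the portmanteau theorem by a sandwich argument,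
since the half-widths `z (W_{g_n})^{1/2}` converge.
-/

namespace QuasiBayes

/-! ### Mixtures and posterior weights -/

section Grid

variable {d : ℕ} {ϑ : Fin d → ℝ}

lemma hasSum_pois (θ : ℝ) : HasSum (fun y : ℕ => pois y θ) 1 := by
  have h : HasSum (fun y : ℕ => θ ^ y / (y.factorial : ℝ)) (Real.exp θ) := by
    rw [Real.exp_eq_exp_ℝ]
    exact NormedSpace.expSeries_div_hasSum_exp θ
  simpa [pois, mul_div_assoc, ← Real.exp_add] using h.mul_left (Real.exp (-θ))

lemma mixture_nonneg (hϑ : ∀ j, 0 < ϑ j) {g : Fin d → ℝ} (hg : g ∈ stdSimplex ℝ (Fin d)) (z : ℕ) :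
    0 ≤ mixture ϑ g z :=
  Finset.sum_nonneg fun j _ => mul_nonneg (pois_pos (hϑ j) z).le (hg.1 j)

lemma exists_pos_of_mem_stdSimplex {g : Fin d → ℝ} (hg : g ∈ stdSimplex ℝ (Fin d)) :
    ∃ j, 0 < g j := by
  by_contra! h
  have := hg.2
  rw [Finset.sum_eq_zero fun j _ => le_antisymm (h j) (hg.1 j)] at this
  exact zero_ne_one this

lemma mixture_pos (hϑ : ∀ j, 0 < ϑ j) {g : Fin d → ℝ} (hg : g ∈ stdSimplex ℝ (Fin d)) (z : ℕ) :
    0 < mixture ϑ g z := by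
  obtain ⟨j, hj⟩ := exists_pos_of_mem_stdSimplex hg
  exact Finset.sum_pos' (fun j _ => mul_nonneg (pois_pos (hϑ j) z).le (hg.1 j))
    ⟨j, Finset.mem_univ j, mul_pos (pois_pos (hϑ j) z) hj⟩

lemma hasSum_mixture {g : Fin d → ℝ} (hg : g ∈ stdSimplex ℝ (Fin d)) :
    HasSum (fun z => mixture ϑ g z) 1 := by
  have h := hasSum_sum (s := Finset.univ) fun j (_ : j ∈ Finset.univ) =>
    (hasSum_pois (ϑ j)).mul_right (g j)
  simpa [mixture, hg.2] using h

lemma mixture_mul_postWeight (hϑ : ∀ j, 0 < ϑ j) {g : Fin d → ℝ}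
    (hg : g ∈ stdSimplex ℝ (Fin d)) (z : ℕ) (j : Fin d) :
    mixture ϑ g z * postWeight ϑ g z j = pois z (ϑ j) * g j := by
  rw [postWeight, mul_div_cancel₀ _ (mixture_pos hϑ hg z).ne']

lemma postWeight_mem (hϑ : ∀ j, 0 < ϑ j) {g : Fin d → ℝ}
    (hg : g ∈ stdSimplex ℝ (Fin d)) (z : ℕ) : postWeight ϑ g z ∈ stdSimplex ℝ (Fin d) := by
  refine ⟨fun j => div_nonneg (mul_nonneg (pois_pos (hϑ j) z).le (hg.1 j))
    (mixture_nonneg hϑ hg z), ?_⟩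
  simp only [postWeight]
  rw [← Finset.sum_div]
  exact div_self (mixture_pos hϑ hg z).ne'

lemma newton_mem (hϑ : ∀ j, 0 < ϑ j) {α : ℕ → ℝ} (hα : ∀ n, 1 ≤ n → α n ∈ Set.Ioo (0 : ℝ) 1)
    {g₀ : Fin d → ℝ} (hg : g₀ ∈ stdSimplex ℝ (Fin d)) (y : ℕ → ℕ) (n : ℕ) :
    newton ϑ α g₀ y n ∈ stdSimplex ℝ (Fin d) := by
  induction n with
  | zero => exact hg
  | succ n ih =>
    have h := hα (n + 1) (by omega)
    exact convex_stdSimplex ℝ (Fin d) ih (postWeight_mem hϑ ih (y (n + 1)))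
      (by linarith [h.2]) h.1.le (by ring)

/-- Averaging the posterior weights over the predictive distribution gives back the prior
weights; this makes the recursion a martingale. -/
lemma hasSum_mixture_mul_postWeight (hϑ : ∀ j, 0 < ϑ j) {g : Fin d → ℝ}
    (hg : g ∈ stdSimplex ℝ (Fin d)) (j : Fin d) :
    HasSum (fun z => mixture ϑ g z * postWeight ϑ g z j) (g j) := by
  simp only [mixture_mul_postWeight hϑ hg]
  simpa using (hasSum_pois (ϑ j)).mul_right (g j)

lemma abs_sum_mul_le {u g : Fin d → ℝ} {U : ℝ} (hu : ∀ j, |u j| ≤ U)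
    (hg : g ∈ stdSimplex ℝ (Fin d)) : |∑ j, u j * g j| ≤ U := by
  refine (Finset.abs_sum_le_sum_abs _ _).trans ?_
  calc ∑ j, |u j * g j| ≤ ∑ j, U * g j := by
        refine Finset.sum_le_sum fun j _ => ?_
        rw [abs_mul, abs_of_nonneg (hg.1 j)]
        exact mul_le_mul_of_nonneg_right (hu j) (hg.1 j)
    _ = U := by rw [← Finset.mul_sum, hg.2, mul_one]

/-! ### The one-step conditional variance -/

/-- The fluctuation `⟨u, posterior - g⟩` along `u` of one Bayesian update of `g` by the
observation `z`. -/
noncomputable def updateDir (ϑ : Fin d → ℝ) (u g : Fin d → ℝ) (z : ℕ) : ℝ :=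
  ∑ j, u j * (postWeight ϑ g z j - g j)

/-- The variance of `updateDir ϑ u g Z` when `Z` has probability mass function `p_g`. -/
noncomputable def dirVar (ϑ : Fin d → ℝ) (u g : Fin d → ℝ) : ℝ :=
  ∑' z : ℕ, mixture ϑ g z * updateDir ϑ u g z ^ 2

lemma updateDir_eq_sub (u g : Fin d → ℝ) (z : ℕ) :
    updateDir ϑ u g z = ∑ j, u j * postWeight ϑ g z j - ∑ j, u j * g j := by
  simp [updateDir, mul_sub]

lemma abs_updateDir_le (hϑ : ∀ j, 0 < ϑ j) {u g : Fin d → ℝ} {U : ℝ} (hu : ∀ j, |u j| ≤ U)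
    (hg : g ∈ stdSimplex ℝ (Fin d)) (z : ℕ) : |updateDir ϑ u g z| ≤ 2 * U := by
  rw [updateDir_eq_sub]
  have h1 := abs_sum_mul_le hu (postWeight_mem hϑ hg z)
  have h2 := abs_sum_mul_le hu hg
  exact (abs_sub _ _).trans (by linarith)

lemma hasSum_mixture_mul_updateDir (hϑ : ∀ j, 0 < ϑ j) (u : Fin d → ℝ) {g : Fin d → ℝ}
    (hg : g ∈ stdSimplex ℝ (Fin d)) :
    HasSum (fun z => mixture ϑ g z * updateDir ϑ u g z) 0 := by
  have h1 := hasSum_sum (s := Finset.univ) fun j (_ : j ∈ Finset.univ) =>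
    (((hasSum_mixture_mul_postWeight hϑ hg j).sub ((hasSum_mixture (ϑ := ϑ) hg).mul_right (g j))
      ).mul_left (u j))
  simp only [one_mul, sub_self, mul_zero, Finset.sum_const_zero] at h1
  refine h1.congr_fun fun z => ?_
  rw [updateDir, Finset.mul_sum]
  exact Finset.sum_congr rfl fun j _ => by ring

lemma hasSum_dirVar (hϑ : ∀ j, 0 < ϑ j) {u g : Fin d → ℝ} {U : ℝ} (hu : ∀ j, |u j| ≤ U)
    (hg : g ∈ stdSimplex ℝ (Fin d)) :
    HasSum (fun z => mixture ϑ g z * updateDir ϑ u g z ^ 2) (dirVar ϑ u g) := by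
  refine (Summable.of_nonneg_of_le (fun z => mul_nonneg (mixture_nonneg hϑ hg z) (sq_nonneg _))
    (fun z => ?_) ((hasSum_mixture (ϑ := ϑ) hg).mul_right ((2 * U) ^ 2)).summable).hasSum
  exact mul_le_mul_of_nonneg_left (sq_le_sq' (by linarith [abs_le.1 (abs_updateDir_le hϑ hu hg z)])
    (abs_le.1 (abs_updateDir_le hϑ hu hg z)).2) (mixture_nonneg hϑ hg z)

lemma dirVar_nonneg (hϑ : ∀ j, 0 < ϑ j) (u : Fin d → ℝ) {g : Fin d → ℝ}
    (hg : g ∈ stdSimplex ℝ (Fin d)) : 0 ≤ dirVar ϑ u g :=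
  tsum_nonneg fun z => mul_nonneg (mixture_nonneg hϑ hg z) (sq_nonneg _)

lemma dirVar_le (hϑ : ∀ j, 0 < ϑ j) {u g : Fin d → ℝ} {U : ℝ} (hu : ∀ j, |u j| ≤ U)
    (hg : g ∈ stdSimplex ℝ (Fin d)) : dirVar ϑ u g ≤ 4 * U ^ 2 := by
  have h := (hasSum_mixture (ϑ := ϑ) hg).mul_right ((2 * U) ^ 2)
  have := hasSum_le (fun z => mul_le_mul_of_nonneg_left
    (sq_le_sq' (by linarith [abs_le.1 (abs_updateDir_le hϑ hu hg z)])
    (abs_le.1 (abs_updateDir_le hϑ hu hg z)).2) (mixture_nonneg hϑ hg z))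
    (hasSum_dirVar hϑ hu hg) h
  linarith

/-- The function `(b, p) ↦ b² / p` is Lipschitz on the cone `|b| ≤ C p`. -/
lemma abs_mul_sq_sub_mul_sq_le {p p' r r' C : ℝ} (hr : |r| ≤ C) (hr' : |r'| ≤ C) :
    |p * r ^ 2 - p' * r' ^ 2| ≤ 2 * C * |p * r - p' * r'| + C ^ 2 * |p - p'| := by
  have hC : 0 ≤ C := (abs_nonneg r).trans hr
  have h1 : p * r ^ 2 - p' * r' ^ 2 = (r + r') * (p * r - p' * r') - r * r' * (p - p') := by ring
  rw [h1]
  refine (abs_sub _ _).trans ?_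
  rw [abs_mul, abs_mul, abs_mul]
  have h2 : |r + r'| ≤ 2 * C := (abs_add_le _ _).trans (by linarith)
  have h3 : |r| * |r'| ≤ C ^ 2 := by
    rw [sq]; exact mul_le_mul hr hr' (abs_nonneg _) hC
  gcongr

lemma mixture_sub (g h : Fin d → ℝ) (z : ℕ) :
    mixture ϑ g z - mixture ϑ h z = ∑ j, pois z (ϑ j) * (g j - h j) := by
  simp [mixture, mul_sub]

lemma mixture_mul_updateDir (hϑ : ∀ j, 0 < ϑ j) (u : Fin d → ℝ) {g : Fin d → ℝ}
    (hg : g ∈ stdSimplex ℝ (Fin d)) (z : ℕ) :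
    mixture ϑ g z * updateDir ϑ u g z
      = ∑ j, (u j - ∑ i, u i * g i) * (pois z (ϑ j) * g j) := by
  rw [updateDir_eq_sub, mul_sub, Finset.mul_sum]
  simp only [sub_mul, Finset.sum_sub_distrib]
  congr 1
  · refine Finset.sum_congr rfl fun j _ => ?_
    rw [← mixture_mul_postWeight hϑ hg]; ring
  · rw [← Finset.mul_sum, mul_comm]; rfl

/-- The one-step variance is Lipschitz in the weights: `p_g(z) (updateDir z)²` is of the form
`b² / p` with `b` and `p` Lipschitz in `g`, and the Lipschitz constants are summable over `z`. -/
lemma abs_dirVar_sub_le (hϑ : ∀ j, 0 < ϑ j) {u g h : Fin d → ℝ} {U : ℝ} (hu : ∀ j, |u j| ≤ U)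
    (hg : g ∈ stdSimplex ℝ (Fin d)) (hh : h ∈ stdSimplex ℝ (Fin d)) :
    |dirVar ϑ u g - dirVar ϑ u h| ≤ 16 * U ^ 2 * ∑ j, |g j - h j| := by
  obtain ⟨j0, -⟩ := exists_pos_of_mem_stdSimplex hg
  have hU : 0 ≤ U := (abs_nonneg _).trans (hu j0)
  set δ := ∑ j, |g j - h j| with hδ
  have hc : |∑ i, u i * g i - ∑ i, u i * h i| ≤ U * δ := by
    rw [← Finset.sum_sub_distrib, hδ, Finset.mul_sum]
    refine (Finset.abs_sum_le_sum_abs _ _).trans (Finset.sum_le_sum fun j _ => ?_)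
    rw [← mul_sub, abs_mul]
    exact mul_le_mul_of_nonneg_right (hu j) (abs_nonneg _)
  have hp : ∀ z, |mixture ϑ g z - mixture ϑ h z| ≤ ∑ j, pois z (ϑ j) * |g j - h j| := fun z => by
    rw [mixture_sub]
    refine (Finset.abs_sum_le_sum_abs _ _).trans (Finset.sum_le_sum fun j _ => ?_)
    rw [abs_mul, abs_of_pos (pois_pos (hϑ j) z)]
  have hb : ∀ z, |mixture ϑ g z * updateDir ϑ u g z - mixture ϑ h z * updateDir ϑ u h z|
      ≤ 2 * U * ∑ j, pois z (ϑ j) * |g j - h j| + U * δ * mixture ϑ h z := fun z => by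
    have h1 : mixture ϑ g z * updateDir ϑ u g z - mixture ϑ h z * updateDir ϑ u h z
        = ∑ j, (u j - ∑ i, u i * g i) * (pois z (ϑ j) * (g j - h j))
          - (∑ i, u i * g i - ∑ i, u i * h i) * mixture ϑ h z := by
      rw [mixture_mul_updateDir hϑ u hg, mixture_mul_updateDir hϑ u hh, mixture,
        Finset.mul_sum, ← Finset.sum_sub_distrib,
        ← Finset.sum_sub_distrib]
      exact Finset.sum_congr rfl fun j _ => by ring
    rw [h1]
    refine (abs_sub _ _).trans (add_le_add ?_ ?_)
    · rw [Finset.mul_sum]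
      refine (Finset.abs_sum_le_sum_abs _ _).trans (Finset.sum_le_sum fun j _ => ?_)
      rw [abs_mul, abs_mul, abs_of_pos (pois_pos (hϑ j) z)]
      refine mul_le_mul_of_nonneg_right ?_ (mul_nonneg (pois_pos (hϑ j) z).le (abs_nonneg _))
      exact (abs_sub _ _).trans (by linarith [hu j, abs_sum_mul_le hu hg])
    · rw [abs_mul, abs_of_pos (mixture_pos hϑ hh z)]
      exact mul_le_mul_of_nonneg_right hc (mixture_nonneg hϑ hh z)
  have hsum : HasSum (fun z => 12 * U ^ 2 * ∑ j, pois z (ϑ j) * |g j - h j|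
      + 4 * U ^ 2 * δ * mixture ϑ h z) (16 * U ^ 2 * δ) := by
    have h1 := hasSum_sum (s := Finset.univ) fun j (_ : j ∈ Finset.univ) =>
      (hasSum_pois (ϑ j)).mul_right |g j - h j|
    have h2 := (h1.mul_left (12 * U ^ 2)).add
      ((hasSum_mixture (ϑ := ϑ) hh).mul_left (4 * U ^ 2 * δ))
    have h3 : 16 * U ^ 2 * δ = 12 * U ^ 2 * ∑ j, 1 * |g j - h j| + 4 * U ^ 2 * δ * 1 := by
      simp only [one_mul, mul_one]
      rw [← hδ]; ring
    rw [h3]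
    exact h2
  have hdiff := (hasSum_dirVar hϑ hu hg).sub (hasSum_dirVar hϑ hu hh)
  rw [← hdiff.tsum_eq, ← hsum.tsum_eq, ← Real.norm_eq_abs]
  refine tsum_of_norm_bounded hsum.summable.hasSum fun z => ?_
  rw [Real.norm_eq_abs]
  refine (abs_mul_sq_sub_mul_sq_le (abs_updateDir_le hϑ hu hg z)
    (abs_updateDir_le hϑ hu hh z)).trans ?_
  calc 2 * (2 * U) * |mixture ϑ g z * updateDir ϑ u g z - mixture ϑ h z * updateDir ϑ u h z|
        + (2 * U) ^ 2 * |mixture ϑ g z - mixture ϑ h z|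
      ≤ 2 * (2 * U) * (2 * U * ∑ j, pois z (ϑ j) * |g j - h j| + U * δ * mixture ϑ h z)
        + (2 * U) ^ 2 * ∑ j, pois z (ϑ j) * |g j - h j| := by
          gcongr
          · exact hb z
          · exact hp z
    _ = _ := by ring

/-! ### The estimator as a function of the weights -/

/-- The gradient of the estimator `g ↦ (y + 1) p_g(y + 1) / p_g(y)`. -/
noncomputable def estimateGrad (ϑ : Fin d → ℝ) (g : Fin d → ℝ) (y : ℕ) (j : Fin d) : ℝ :=
  ((y : ℝ) + 1) * (pois (y + 1) (ϑ j) / mixture ϑ g y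
    - mixture ϑ g (y + 1) * pois y (ϑ j) / mixture ϑ g y ^ 2)

/-- The estimator is a quotient of linear functions, so its increment equals its differential up
to an explicit factor. -/
lemma estimate_sub (hϑ : ∀ j, 0 < ϑ j) {g h : Fin d → ℝ} (hg : g ∈ stdSimplex ℝ (Fin d))
    (hh : h ∈ stdSimplex ℝ (Fin d)) (y : ℕ) :
    estimate ϑ h y - estimate ϑ g y
      = (∑ j, estimateGrad ϑ g y j * (h j - g j)) * (mixture ϑ g y / mixture ϑ h y) := by
  have hD := (mixture_pos hϑ hg y).ne'
  have hD' := (mixture_pos hϑ hh y).ne'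
  have h1 : ∑ j, estimateGrad ϑ g y j * (h j - g j)
      = ((y : ℝ) + 1) * ((mixture ϑ h (y + 1) - mixture ϑ g (y + 1)) / mixture ϑ g y
        - mixture ϑ g (y + 1) * (mixture ϑ h y - mixture ϑ g y) / mixture ϑ g y ^ 2) := by
    rw [mixture_sub, mixture_sub, Finset.mul_sum, Finset.sum_div, Finset.sum_div,
      ← Finset.sum_sub_distrib, Finset.mul_sum]
    refine Finset.sum_congr rfl fun j _ => ?_
    rw [estimateGrad]; ring
  rw [h1, estimate, estimate]
  field_simp
  ring

/-- A lower bound for all mixtures at `y`. -/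
lemma exists_le_mixture (hϑ : ∀ j, 0 < ϑ j) (y : ℕ) :
    ∃ c, 0 < c ∧ ∀ g ∈ stdSimplex ℝ (Fin d), c ≤ mixture ϑ g y := by
  rcases isEmpty_or_nonempty (Fin d) with hd | hd
  · refine ⟨1, one_pos, fun g hg => ?_⟩
    obtain ⟨j, -⟩ := exists_pos_of_mem_stdSimplex hg
    exact isEmptyElim j
  · obtain ⟨i, hi⟩ := Finite.exists_min fun j => pois y (ϑ j)
    refine ⟨pois y (ϑ i), pois_pos (hϑ i) y, fun g hg => ?_⟩
    calc pois y (ϑ i) = ∑ j, pois y (ϑ i) * g j := by rw [← Finset.mul_sum, hg.2, mul_one]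
      _ ≤ _ := Finset.sum_le_sum fun j _ => mul_le_mul_of_nonneg_right (hi j) (hg.1 j)

lemma pois_le_one {θ : ℝ} (hθ : 0 < θ) (y : ℕ) : pois y θ ≤ 1 :=
  le_hasSum (hasSum_pois θ) y fun z _ => (pois_pos hθ z).le

lemma mixture_le_one (hϑ : ∀ j, 0 < ϑ j) {g : Fin d → ℝ} (hg : g ∈ stdSimplex ℝ (Fin d)) (y : ℕ) :
    mixture ϑ g y ≤ 1 :=
  le_hasSum (hasSum_mixture hg) y fun z _ => mixture_nonneg hϑ hg z

lemma exists_abs_estimateGrad_le (hϑ : ∀ j, 0 < ϑ j) (y : ℕ) :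
    ∃ U, 0 ≤ U ∧ ∀ g ∈ stdSimplex ℝ (Fin d), ∀ j, |estimateGrad ϑ g y j| ≤ U := by
  obtain ⟨c, hc, hle⟩ := exists_le_mixture hϑ y
  refine ⟨((y : ℝ) + 1) * (1 / c + 1 / c ^ 2), by positivity, fun g hg j => ?_⟩
  have hD := mixture_pos hϑ hg y
  have h1 : 0 ≤ pois (y + 1) (ϑ j) / mixture ϑ g y := div_nonneg (pois_pos (hϑ j) _).le hD.le
  have h2 : 0 ≤ mixture ϑ g (y + 1) * pois y (ϑ j) / mixture ϑ g y ^ 2 :=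
    div_nonneg (mul_nonneg (mixture_nonneg hϑ hg _) (pois_pos (hϑ j) _).le) (sq_nonneg _)
  have h3 : pois (y + 1) (ϑ j) / mixture ϑ g y ≤ 1 / c :=
    div_le_div₀ zero_le_one (pois_le_one (hϑ j) _) hc (hle g hg)
  have h4 : mixture ϑ g (y + 1) * pois y (ϑ j) / mixture ϑ g y ^ 2 ≤ 1 / c ^ 2 :=
    div_le_div₀ zero_le_one (mul_le_one₀ (mixture_le_one hϑ hg _) (pois_pos (hϑ j) _).le
      (pois_le_one (hϑ j) _)) (by positivity) (pow_le_pow_left₀ hc.le (hle g hg) 2)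
  rw [estimateGrad, abs_mul, abs_of_pos (by positivity : (0 : ℝ) < (y : ℝ) + 1)]
  refine mul_le_mul_of_nonneg_left ?_ (by positivity)
  refine (abs_sub _ _).trans ?_
  rw [abs_of_nonneg h1, abs_of_nonneg h2]
  exact add_le_add h3 h4

/-- The first-order remainder of the estimator is quadratic, uniformly over the simplex. -/
lemma exists_abs_estimate_remainder_le (hϑ : ∀ j, 0 < ϑ j) (y : ℕ) :
    ∃ C, 0 ≤ C ∧ ∀ g ∈ stdSimplex ℝ (Fin d), ∀ h ∈ stdSimplex ℝ (Fin d),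
      |estimate ϑ h y - estimate ϑ g y - ∑ j, estimateGrad ϑ g y j * (h j - g j)|
        ≤ C * ∑ j, (h j - g j) ^ 2 := by
  obtain ⟨c, hc, hle⟩ := exists_le_mixture hϑ y
  obtain ⟨U, hU0, hU⟩ := exists_abs_estimateGrad_le hϑ y
  refine ⟨U * d / c, by positivity, fun g hg h hh => ?_⟩
  have hD' := mixture_pos hϑ hh y
  set S := ∑ j, estimateGrad ϑ g y j * (h j - g j) with hS
  have h1 : estimate ϑ h y - estimate ϑ g y - S
      = S * (mixture ϑ g y - mixture ϑ h y) / mixture ϑ h y := by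
    rw [estimate_sub hϑ hg hh, ← hS]
    field_simp
  have hSle : |S| ≤ U * ∑ j, |h j - g j| := by
    rw [hS, Finset.mul_sum]
    refine (Finset.abs_sum_le_sum_abs _ _).trans (Finset.sum_le_sum fun j _ => ?_)
    rw [abs_mul]
    exact mul_le_mul_of_nonneg_right (hU g hg j) (abs_nonneg _)
  have hDle : |mixture ϑ g y - mixture ϑ h y| ≤ ∑ j, |h j - g j| := by
    rw [mixture_sub]
    refine (Finset.abs_sum_le_sum_abs _ _).trans (Finset.sum_le_sum fun j _ => ?_)
    rw [abs_mul, abs_of_pos (pois_pos (hϑ j) y), abs_sub_comm]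
    exact mul_le_of_le_one_left (abs_nonneg _) (pois_le_one (hϑ j) y)
  have hsq : (∑ j, |h j - g j|) ^ 2 ≤ d * ∑ j, (h j - g j) ^ 2 := by
    have := sq_sum_le_card_mul_sum_sq (s := (Finset.univ : Finset (Fin d)))
      (f := fun j => |h j - g j|)
    simpa using this
  rw [h1, abs_div, abs_mul, abs_of_pos hD', div_le_iff₀ hD']
  calc |S| * |mixture ϑ g y - mixture ϑ h y|
      ≤ (U * ∑ j, |h j - g j|) * ∑ j, |h j - g j| := by gcongr
    _ = U * (∑ j, |h j - g j|) ^ 2 := by ring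
    _ ≤ U * (d * ∑ j, (h j - g j) ^ 2) := by gcongr
    _ = U * d / c * (∑ j, (h j - g j) ^ 2) * c := by field_simp
    _ ≤ U * d / c * (∑ j, (h j - g j) ^ 2) * mixture ϑ h y := by
        refine mul_le_mul_of_nonneg_left (hle h hh) ?_
        exact mul_nonneg (by positivity) (Finset.sum_nonneg fun j _ => sq_nonneg _)

lemma updateDir_estimateGrad (hϑ : ∀ j, 0 < ϑ j) {g : Fin d → ℝ} (hg : g ∈ stdSimplex ℝ (Fin d))
    (y z : ℕ) :
    updateDir ϑ (fun j => estimateGrad ϑ g y j) g z = estimate ϑ g y * score ϑ g y z := by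
  have hD := (mixture_pos hϑ hg y).ne'
  have hN := (mixture_pos hϑ hg (y + 1)).ne'
  have hgrad : ∀ j, estimateGrad ϑ g y j = estimate ϑ g y *
      (pois (y + 1) (ϑ j) / mixture ϑ g (y + 1) - pois y (ϑ j) / mixture ϑ g y) := fun j => by
    rw [estimateGrad, estimate]
    field_simp
  -- the gradient is orthogonal to `g` since the estimator is homogeneous of degree zero
  have h0 : ∑ j, estimateGrad ϑ g y j * g j = 0 := by
    have : ∀ j, estimateGrad ϑ g y j * g j = estimate ϑ g y *
        (pois (y + 1) (ϑ j) * g j / mixture ϑ g (y + 1) - pois y (ϑ j) * g j / mixture ϑ g y) :=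
      fun j => by rw [hgrad]; ring
    rw [Finset.sum_congr rfl fun j _ => this j, ← Finset.mul_sum, Finset.sum_sub_distrib,
      ← Finset.sum_div, ← Finset.sum_div]
    change estimate ϑ g y * (mixture ϑ g (y + 1) / mixture ϑ g (y + 1)
      - mixture ϑ g y / mixture ϑ g y) = 0
    rw [div_self hD, div_self hN, sub_self, mul_zero]
  rw [updateDir_eq_sub, h0, sub_zero, score, Finset.mul_sum]
  exact Finset.sum_congr rfl fun j _ => by rw [hgrad]; ring

/-- The asymptotic variance is the one-step variance along the gradient of the estimator. -/
lemma dirVar_estimateGrad (hϑ : ∀ j, 0 < ϑ j) {g : Fin d → ℝ} (hg : g ∈ stdSimplex ℝ (Fin d))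
    (y : ℕ) : dirVar ϑ (fun j => estimateGrad ϑ g y j) g = asympVar ϑ g y := by
  rw [dirVar, asympVar, ← tsum_mul_left]
  refine tsum_congr fun z => ?_
  rw [updateDir_estimateGrad hϑ hg]; ring

lemma asympVar_nonneg (hϑ : ∀ j, 0 < ϑ j) {g : Fin d → ℝ} (hg : g ∈ stdSimplex ℝ (Fin d))
    (y : ℕ) : 0 ≤ asympVar ϑ g y := by
  rw [← dirVar_estimateGrad hϑ hg]
  exact dirVar_nonneg hϑ _ hg

lemma continuous_mixture (y : ℕ) : Continuous fun g : Fin d → ℝ => mixture ϑ g y := by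
  unfold mixture; fun_prop

lemma continuousOn_estimate (hϑ : ∀ j, 0 < ϑ j) (y : ℕ) :
    ContinuousOn (fun g => estimate ϑ g y) (stdSimplex ℝ (Fin d)) := by
  unfold estimate
  exact (((continuous_mixture (y + 1)).const_mul _).continuousOn).div
    (continuous_mixture y).continuousOn fun g hg => (mixture_pos hϑ hg y).ne'

lemma continuousOn_estimateGrad (hϑ : ∀ j, 0 < ϑ j) (y : ℕ) (j : Fin d) :
    ContinuousOn (fun g => estimateGrad ϑ g y j) (stdSimplex ℝ (Fin d)) := by
  unfold estimateGrad
  refine ((continuousOn_const.div (continuous_mixture y).continuousOn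
    fun g hg => (mixture_pos hϑ hg y).ne').sub ?_).const_mul _
  exact (((continuous_mixture (y + 1)).mul_const _).continuousOn).div
    ((continuous_mixture y).pow 2).continuousOn fun g hg => (pow_pos (mixture_pos hϑ hg y) 2).ne'

lemma continuousOn_asympVar (hϑ : ∀ j, 0 < ϑ j) (y : ℕ) :
    ContinuousOn (fun g => asympVar ϑ g y) (stdSimplex ℝ (Fin d)) := by
  obtain ⟨U, hU0, hU⟩ := exists_abs_estimateGrad_le hϑ y
  have h : ContinuousOn (fun g => dirVar ϑ (fun j => estimateGrad ϑ g y j) g)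
      (stdSimplex ℝ (Fin d)) := by
    unfold dirVar
    refine continuousOn_tsum (u := fun z => (∑ j, pois z (ϑ j)) * (2 * U) ^ 2) (fun z => ?_)
      ((summable_sum fun j _ => summable_pois (ϑ j)).mul_right _) (fun z g hg => ?_)
    · refine (continuous_mixture z).continuousOn.mul (ContinuousOn.pow ?_ 2)
      unfold updateDir
      refine continuousOn_finsetSum _ fun j _ => (continuousOn_estimateGrad hϑ y j).mul ?_
      refine ContinuousOn.sub ?_ (continuous_apply j).continuousOn
      unfold postWeight
      exact (((continuous_apply j).const_mul _).continuousOn).div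
        (continuous_mixture z).continuousOn fun g hg => (mixture_pos hϑ hg z).ne'
    · rw [Real.norm_eq_abs, abs_mul, abs_of_pos (mixture_pos hϑ hg z), abs_of_nonneg (sq_nonneg _)]
      have hup := abs_updateDir_le hϑ (u := fun j => estimateGrad ϑ g y j) (hU g hg) hg z
      refine mul_le_mul (Finset.sum_le_sum fun j _ => ?_) ?_ (sq_nonneg _)
        (Finset.sum_nonneg fun j _ => (pois_pos (hϑ j) z).le)
      · refine mul_le_of_le_one_right (pois_pos (hϑ j) z).le ?_
        rw [← hg.2]
        exact Finset.single_le_sum (fun i _ => hg.1 i) (Finset.mem_univ j)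
      · exact sq_le_sq' (by linarith [abs_le.1 hup]) (abs_le.1 hup).2
  exact h.congr fun g hg => (dirVar_estimateGrad hϑ hg y).symm

end Grid

/-! ### Characteristic functions of martingales with bounded increments -/

section CharFun

lemma abs_one_sub_sub_exp_neg_le {x : ℝ} (hx : 0 ≤ x) : |1 - x - Real.exp (-x)| ≤ x ^ 2 / 2 := by
  have h1 : 1 - x ≤ Real.exp (-x) := by linarith [Real.add_one_le_exp (-x)]
  have h2 : 1 + x + x ^ 2 / 2 ≤ Real.exp x := Real.quadratic_le_exp_of_nonneg hx
  have h3 : Real.exp (-x) ≤ 1 - x + x ^ 2 / 2 := by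
    rw [Real.exp_neg]
    refine (inv_anti₀ (by positivity) h2).trans ?_
    rw [inv_le_iff_one_le_mul₀ (by positivity)]
    nlinarith [sq_nonneg (x ^ 2)]
  rw [abs_le]
  constructor <;> linarith

lemma norm_exp_I_mul_taylor_le (x : ℝ) :
    ‖Complex.exp (Complex.I * x) - (1 + Complex.I * x - (x : ℂ) ^ 2 / 2)‖
      ≤ |x| ^ 3 * Real.exp |x| := by
  have h := Complex.norm_exp_sub_sum_le_norm_mul_exp (Complex.I * x) 3
  simp only [norm_mul, Complex.norm_I, one_mul, Complex.norm_real, Real.norm_eq_abs] at h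
  convert h using 3
  simp [Finset.sum_range_succ, mul_pow, Nat.factorial]
  ring

variable {Ω : Type*} {m0 : MeasurableSpace Ω}

lemma integrable_of_measurable_of_bound {E : Type*} [NormedAddCommGroup E] [MeasurableSpace E]
    [BorelSpace E] [SecondCountableTopology E] {ν : Measure Ω} [IsFiniteMeasure ν]
    {f : Ω → E} (hf : Measurable f) (C : ℝ) (h : ∀ ω, ‖f ω‖ ≤ C) : Integrable f ν :=
  Integrable.of_bound hf.aestronglyMeasurable C (Eventually.of_forall h)

/-- One step of the comparison: if, conditionally on the past, `D` has mean zero and variance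
`a² v`, then its characteristic function at `s` is close to `exp (-s² a² w / 2)`. -/
lemma norm_integral_mul_exp_sub_exp_le {ν : Measure Ω} [IsFiniteMeasure ν] {H : Ω → ℂ}
    {D v w : Ω → ℝ} {a c V δ : ℝ} (s : ℝ) (hH : Measurable H) (hH1 : ∀ ω, ‖H ω‖ ≤ 1)
    (hD : Measurable D) (hDc : ∀ ω, |D ω| ≤ c * a) (hv : Measurable v) (hw : Measurable w)
    (hv0 : ∀ ω, 0 ≤ v ω) (hvV : ∀ ω, v ω ≤ V) (hw0 : ∀ ω, 0 ≤ w ω) (hwV : ∀ ω, w ω ≤ V)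
    (h1 : ∫ ω, H ω * (D ω : ℂ) ∂ν = 0)
    (h2 : ∫ ω, H ω * ((D ω ^ 2 : ℝ) : ℂ) ∂ν = ∫ ω, H ω * ((a ^ 2 * v ω : ℝ) : ℂ) ∂ν)
    (hδ : ∫ ω, |v ω - w ω| ∂ν ≤ δ * ν.real Set.univ) :
    ‖∫ ω, H ω * (Complex.exp (Complex.I * ((s * D ω : ℝ) : ℂ))
        - (Real.exp (-(s ^ 2 * a ^ 2 / 2 * w ω)) : ℂ)) ∂ν‖
      ≤ ((c * |s| * a) ^ 3 * Real.exp (c * |s| * a) + s ^ 2 * a ^ 2 / 2 * δ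
          + (s ^ 2 * a ^ 2 / 2 * V) ^ 2 / 2) * ν.real Set.univ := by
  -- Taylor remainder of the characteristic function, and what remains once the first two moments
  -- of `D` have been replaced by their conditional values
  set E₁ : Ω → ℂ := fun ω => Complex.exp (Complex.I * ((s * D ω : ℝ) : ℂ))
    - (1 + Complex.I * ((s * D ω : ℝ) : ℂ) - ((s * D ω : ℝ) : ℂ) ^ 2 / 2) with hE₁
  set E₂ : Ω → ℝ := fun ω => 1 - s ^ 2 * a ^ 2 / 2 * v ω
    - Real.exp (-(s ^ 2 * a ^ 2 / 2 * w ω)) with hE₂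
  have hE₁m : Measurable E₁ := by rw [hE₁]; fun_prop
  have hE₂m : Measurable E₂ := by rw [hE₂]; fun_prop
  have hE₁b : ∀ ω, ‖E₁ ω‖ ≤ (c * |s| * a) ^ 3 * Real.exp (c * |s| * a) := fun ω => by
    refine (norm_exp_I_mul_taylor_le (s * D ω)).trans ?_
    have h : |s * D ω| ≤ c * |s| * a := by
      rw [abs_mul]
      calc |s| * |D ω| ≤ |s| * (c * a) := mul_le_mul_of_nonneg_left (hDc ω) (abs_nonneg _)
        _ = _ := by ring
    have h0 := abs_nonneg (s * D ω)
    exact mul_le_mul (pow_le_pow_left₀ h0 h 3) (Real.exp_le_exp.2 h) (Real.exp_nonneg _)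
      (pow_nonneg (h0.trans h) 3)
  have hE₂b : ∀ ω, |E₂ ω| ≤ s ^ 2 * a ^ 2 / 2 * |v ω - w ω|
      + (s ^ 2 * a ^ 2 / 2 * V) ^ 2 / 2 := fun ω => by
    have hx : 0 ≤ s ^ 2 * a ^ 2 / 2 * w ω := mul_nonneg (by positivity) (hw0 ω)
    have hxV : s ^ 2 * a ^ 2 / 2 * w ω ≤ s ^ 2 * a ^ 2 / 2 * V :=
      mul_le_mul_of_nonneg_left (hwV ω) (by positivity)
    have h3 := abs_one_sub_sub_exp_neg_le hx
    have h4 : E₂ ω = -(s ^ 2 * a ^ 2 / 2 * (v ω - w ω))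
        + (1 - s ^ 2 * a ^ 2 / 2 * w ω - Real.exp (-(s ^ 2 * a ^ 2 / 2 * w ω))) := by
      simp only [hE₂]; ring
    rw [h4]
    refine (abs_add_le _ _).trans (add_le_add ?_ (h3.trans ?_))
    · rw [abs_neg, abs_mul, abs_of_nonneg (by positivity : (0 : ℝ) ≤ s ^ 2 * a ^ 2 / 2)]
    · gcongr
  have hvw : Integrable (fun ω => |v ω - w ω|) ν := by
    refine integrable_of_measurable_of_bound (by fun_prop) V fun ω => ?_
    rw [Real.norm_eq_abs, abs_abs, abs_le]
    constructor <;> linarith [hv0 ω, hvV ω, hw0 ω, hwV ω]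
  have hb : ∀ ω, ‖H ω * E₂ ω‖ ≤ s ^ 2 * a ^ 2 / 2 * |v ω - w ω|
      + (s ^ 2 * a ^ 2 / 2 * V) ^ 2 / 2 := fun ω => by
    rw [norm_mul, Complex.norm_real, Real.norm_eq_abs]
    exact (mul_le_of_le_one_left (abs_nonneg _) (hH1 ω)).trans (hE₂b ω)
  have hb1 : ∀ ω, ‖H ω * E₁ ω‖ ≤ (c * |s| * a) ^ 3 * Real.exp (c * |s| * a) := fun ω => by
    rw [norm_mul]
    exact (mul_le_of_le_one_left (norm_nonneg _) (hH1 ω)).trans (hE₁b ω)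
  have hdom : Integrable (fun ω => s ^ 2 * a ^ 2 / 2 * |v ω - w ω|
      + (s ^ 2 * a ^ 2 / 2 * V) ^ 2 / 2) ν := (hvw.const_mul _).add (integrable_const _)
  have i1 : Integrable (fun ω => H ω * E₁ ω) ν :=
    integrable_of_measurable_of_bound (hH.mul hE₁m) _ hb1
  have i2 : Integrable (fun ω => H ω * (E₂ ω : ℂ)) ν :=
    hdom.mono' (hH.mul (Complex.measurable_ofReal.comp hE₂m)).aestronglyMeasurable
      (Eventually.of_forall hb)
  have i3 : Integrable (fun ω => H ω * (D ω : ℂ)) ν := by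
    refine integrable_of_measurable_of_bound (by fun_prop) (c * a) fun ω => ?_
    rw [norm_mul, Complex.norm_real, Real.norm_eq_abs]
    exact (mul_le_of_le_one_left (abs_nonneg _) (hH1 ω)).trans (hDc ω)
  have i4 : Integrable (fun ω => H ω * ((D ω ^ 2 : ℝ) : ℂ)) ν := by
    refine integrable_of_measurable_of_bound (by fun_prop) ((c * a) ^ 2) fun ω => ?_
    rw [norm_mul, Complex.norm_real, Real.norm_eq_abs, abs_pow]
    exact (mul_le_of_le_one_left (by positivity) (hH1 ω)).trans
      (pow_le_pow_left₀ (abs_nonneg _) (hDc ω) 2)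
  have i5 : Integrable (fun ω => H ω * ((a ^ 2 * v ω : ℝ) : ℂ)) ν := by
    refine integrable_of_measurable_of_bound (by fun_prop) (a ^ 2 * V) fun ω => ?_
    rw [norm_mul, Complex.norm_real, Real.norm_eq_abs,
      abs_of_nonneg (mul_nonneg (sq_nonneg a) (hv0 ω))]
    exact (mul_le_of_le_one_left (mul_nonneg (sq_nonneg a) (hv0 ω)) (hH1 ω)).trans
      (mul_le_mul_of_nonneg_left (hvV ω) (sq_nonneg a))
  have hsplit : ∫ ω, H ω * (Complex.exp (Complex.I * ((s * D ω : ℝ) : ℂ))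
        - (Real.exp (-(s ^ 2 * a ^ 2 / 2 * w ω)) : ℂ)) ∂ν
      = ∫ ω, H ω * E₁ ω ∂ν + ∫ ω, H ω * (E₂ ω : ℂ) ∂ν := by
    have e1 : ∀ ω, H ω * (Complex.exp (Complex.I * ((s * D ω : ℝ) : ℂ))
        - (Real.exp (-(s ^ 2 * a ^ 2 / 2 * w ω)) : ℂ))
        = (H ω * E₁ ω + H ω * (E₂ ω : ℂ)) + ((Complex.I * s) * (H ω * (D ω : ℂ))
          + ((s : ℂ) ^ 2 / 2) * (H ω * ((a ^ 2 * v ω : ℝ) : ℂ) - H ω * ((D ω ^ 2 : ℝ) : ℂ))) :=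
      fun ω => by
        simp only [hE₁, hE₂]
        push_cast
        ring
    simp_rw [e1]
    have i12 : Integrable (fun ω => H ω * E₁ ω + H ω * (E₂ ω : ℂ)) ν := i1.add i2
    have i45 : Integrable (fun ω => ((s : ℂ) ^ 2 / 2) *
        (H ω * ((a ^ 2 * v ω : ℝ) : ℂ) - H ω * ((D ω ^ 2 : ℝ) : ℂ))) ν :=
      (i5.sub i4).const_mul ((s : ℂ) ^ 2 / 2)
    have i3' : Integrable (fun ω => (Complex.I * s) * (H ω * (D ω : ℂ))) ν :=
      i3.const_mul (Complex.I * s)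
    have i345 : Integrable (fun ω => (Complex.I * s) * (H ω * (D ω : ℂ)) + ((s : ℂ) ^ 2 / 2) *
        (H ω * ((a ^ 2 * v ω : ℝ) : ℂ) - H ω * ((D ω ^ 2 : ℝ) : ℂ))) ν := i3'.add i45
    rw [integral_add i12 i345, integral_add i1 i2,
      integral_add i3' i45, integral_const_mul, integral_const_mul, integral_sub i5 i4, h1, h2]
    simp
  rw [hsplit]
  refine (norm_add_le _ _).trans ?_
  have n1 : ‖∫ ω, H ω * E₁ ω ∂ν‖
      ≤ (c * |s| * a) ^ 3 * Real.exp (c * |s| * a) * ν.real Set.univ :=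
    norm_integral_le_of_norm_le_const (Eventually.of_forall hb1)
  have n2 : ‖∫ ω, H ω * (E₂ ω : ℂ) ∂ν‖ ≤ s ^ 2 * a ^ 2 / 2 * (δ * ν.real Set.univ)
      + (s ^ 2 * a ^ 2 / 2 * V) ^ 2 / 2 * ν.real Set.univ := by
    refine (norm_integral_le_of_norm_le hdom (Eventually.of_forall hb)).trans ?_
    rw [integral_add (hvw.const_mul _) (integrable_const _), integral_const_mul, integral_const,
      smul_eq_mul, mul_comm (ν.real Set.univ)]
    gcongr
  linarith

/-- A quantitative martingale central limit theorem. A process `M` starting at zero has increments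
bounded by `c aᵣ`, with conditional mean zero and conditional variance `aᵣ² vᵣ`, where `vᵣ` stays
within `δ` of `v₀` in mean. Then the characteristic function of `M R` is close to that of the
Gaussian mixture with variance `v₀ ∑ aᵣ²`. The moment conditions are tested against bounded
functions of the past, and the multiplier `K` makes an induction on `R` possible. -/
lemma norm_integral_exp_martingale_sub_le {ν : Measure Ω} [IsFiniteMeasure ν]
    (ℱ : Filtration ℕ m0) {M v : ℕ → Ω → ℝ} {a : ℕ → ℝ} {c V δ : ℝ} (s : ℝ)
    (hM : ∀ r, Measurable[ℱ r] (M r)) (hM0 : ∀ ω, M 0 ω = 0)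
    (hv : ∀ r, Measurable[ℱ r] (v r)) (hv0 : ∀ r ω, 0 ≤ v r ω) (hvV : ∀ r ω, v r ω ≤ V)
    (hinc : ∀ r ω, |M (r + 1) ω - M r ω| ≤ c * a r)
    (h1 : ∀ r (H : Ω → ℂ), Measurable[ℱ r] H → (∀ ω, ‖H ω‖ ≤ 1) →
      ∫ ω, H ω * ((M (r + 1) ω - M r ω : ℝ) : ℂ) ∂ν = 0)
    (h2 : ∀ r (H : Ω → ℂ), Measurable[ℱ r] H → (∀ ω, ‖H ω‖ ≤ 1) →
      ∫ ω, H ω * (((M (r + 1) ω - M r ω) ^ 2 : ℝ) : ℂ) ∂ν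
        = ∫ ω, H ω * ((a r ^ 2 * v r ω : ℝ) : ℂ) ∂ν)
    (hδ : ∀ r, ∫ ω, |v r ω - v 0 ω| ∂ν ≤ δ * ν.real Set.univ) (R : ℕ) :
    ∀ K : Ω → ℂ, Measurable[ℱ 0] K → (∀ ω, ‖K ω‖ ≤ 1) →
    ‖∫ ω, K ω * (Complex.exp (Complex.I * ((s * M R ω : ℝ) : ℂ))
        - (Real.exp (-(s ^ 2 / 2 * v 0 ω * ∑ r ∈ Finset.range R, a r ^ 2)) : ℂ)) ∂ν‖
      ≤ (∑ r ∈ Finset.range R, ((c * |s| * a r) ^ 3 * Real.exp (c * |s| * a r)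
          + s ^ 2 * a r ^ 2 / 2 * δ + (s ^ 2 * a r ^ 2 / 2 * V) ^ 2 / 2)) * ν.real Set.univ := by
  induction R with
  | zero => intro K _ _; simp [hM0]
  | succ R ih =>
    intro K hK hK1
    have hMm : ∀ r, Measurable (M r) := fun r => (hM r).mono (ℱ.le r) le_rfl
    have hvm : ∀ r, Measurable (v r) := fun r => (hv r).mono (ℱ.le r) le_rfl
    have hexp : ∀ x : ℝ, ‖Complex.exp (Complex.I * (x : ℂ))‖ = 1 := fun x => by
      rw [mul_comm]; exact Complex.norm_exp_ofReal_mul_I x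
    have hK0 : Measurable K := hK.mono (ℱ.le 0) le_rfl
    set H : Ω → ℂ := fun ω => K ω * Complex.exp (Complex.I * ((s * M R ω : ℝ) : ℂ)) with hHdef
    have hH : Measurable[ℱ R] H := by
      have hKR : Measurable[ℱ R] K := hK.mono (ℱ.mono (Nat.zero_le R)) le_rfl
      exact hKR.mul (Complex.measurable_exp.comp
        ((Complex.measurable_ofReal.comp ((hM R).const_mul s)).const_mul Complex.I))
    have hH1 : ∀ ω, ‖H ω‖ ≤ 1 := fun ω => by
      rw [hHdef, norm_mul, hexp, mul_one]; exact hK1 ω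
    set K' : Ω → ℂ := fun ω => K ω * (Real.exp (-(s ^ 2 * a R ^ 2 / 2 * v 0 ω)) : ℂ) with hK'def
    have hK' : Measurable[ℱ 0] K' :=
      hK.mul (Complex.measurable_ofReal.comp
        (Real.measurable_exp.comp ((hv 0).const_mul _).neg))
    have hle1 : ∀ x : ℝ, 0 ≤ x → ‖(Real.exp (-x) : ℂ)‖ ≤ 1 := fun x hx => by
      rw [Complex.norm_real, Real.norm_eq_abs, Real.abs_exp]
      exact Real.exp_le_one_iff.2 (by linarith)
    have hK'1 : ∀ ω, ‖K' ω‖ ≤ 1 := fun ω => by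
      rw [hK'def, norm_mul]
      exact mul_le_one₀ (hK1 ω) (norm_nonneg _)
        (hle1 _ (mul_nonneg (by positivity) (hv0 0 ω)))
    have hstep := norm_integral_mul_exp_sub_exp_le s (ν := ν) (H := H)
      (D := fun ω => M (R + 1) ω - M R ω) (v := v R) (w := v 0) (a := a R) (c := c) (V := V)
      (δ := δ) (hH.mono (ℱ.le R) le_rfl) hH1 ((hMm _).sub (hMm _)) (hinc R) (hvm R) (hvm 0)
      (hv0 R) (hvV R) (hv0 0) (hvV 0) (h1 R H hH hH1) (h2 R H hH hH1) (hδ R)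
    have hih := ih K' hK' hK'1
    have e : ∀ ω, K ω * (Complex.exp (Complex.I * ((s * M (R + 1) ω : ℝ) : ℂ))
        - (Real.exp (-(s ^ 2 / 2 * v 0 ω * ∑ r ∈ Finset.range (R + 1), a r ^ 2)) : ℂ))
        = H ω * (Complex.exp (Complex.I * ((s * (M (R + 1) ω - M R ω) : ℝ) : ℂ))
            - (Real.exp (-(s ^ 2 * a R ^ 2 / 2 * v 0 ω)) : ℂ))
          + K' ω * (Complex.exp (Complex.I * ((s * M R ω : ℝ) : ℂ))
            - (Real.exp (-(s ^ 2 / 2 * v 0 ω * ∑ r ∈ Finset.range R, a r ^ 2)) : ℂ)) := fun ω => by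
      have e1 : Complex.exp (Complex.I * ((s * M (R + 1) ω : ℝ) : ℂ))
          = Complex.exp (Complex.I * ((s * M R ω : ℝ) : ℂ))
            * Complex.exp (Complex.I * ((s * (M (R + 1) ω - M R ω) : ℝ) : ℂ)) := by
        rw [← Complex.exp_add]; congr 1; push_cast; ring
      have e2 : (Real.exp (-(s ^ 2 / 2 * v 0 ω * ∑ r ∈ Finset.range (R + 1), a r ^ 2)) : ℂ)
          = (Real.exp (-(s ^ 2 * a R ^ 2 / 2 * v 0 ω)) : ℂ)
            * (Real.exp (-(s ^ 2 / 2 * v 0 ω * ∑ r ∈ Finset.range R, a r ^ 2)) : ℂ) := by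
        rw [← Complex.ofReal_mul, ← Real.exp_add, Finset.sum_range_succ]; congr 2; ring
      rw [e1, e2, hHdef, hK'def]
      ring
    have hSR : 0 ≤ ∑ r ∈ Finset.range R, a r ^ 2 := Finset.sum_nonneg fun r _ => sq_nonneg _
    have i1 : Integrable (fun ω => H ω * (Complex.exp (Complex.I *
        ((s * (M (R + 1) ω - M R ω) : ℝ) : ℂ))
          - (Real.exp (-(s ^ 2 * a R ^ 2 / 2 * v 0 ω)) : ℂ))) ν := by
      refine integrable_of_measurable_of_bound ((hH.mono (ℱ.le R) le_rfl).mul ?_) (1 * 2)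
        fun ω => ?_
      · have := hMm (R + 1); have := hMm R; have := hvm 0
        fun_prop
      · rw [norm_mul]
        refine mul_le_mul (hH1 ω) ((norm_sub_le _ _).trans ?_) (norm_nonneg _) zero_le_one
        rw [hexp]
        linarith [hle1 _ (mul_nonneg (by positivity : 0 ≤ s ^ 2 * a R ^ 2 / 2) (hv0 0 ω))]
    have i2 : Integrable (fun ω => K' ω * (Complex.exp (Complex.I * ((s * M R ω : ℝ) : ℂ))
          - (Real.exp (-(s ^ 2 / 2 * v 0 ω * ∑ r ∈ Finset.range R, a r ^ 2)) : ℂ))) ν := by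
      refine integrable_of_measurable_of_bound ((hK'.mono (ℱ.le 0) le_rfl).mul ?_) (1 * 2)
        fun ω => ?_
      · have := hMm R; have := hvm 0
        fun_prop
      · rw [norm_mul]
        refine mul_le_mul (hK'1 ω) ((norm_sub_le _ _).trans ?_) (norm_nonneg _) zero_le_one
        rw [hexp]
        linarith [hle1 _ (mul_nonneg (mul_nonneg (by positivity : 0 ≤ s ^ 2 / 2) (hv0 0 ω)) hSR)]
    simp_rw [e]
    rw [integral_add i1 i2, Finset.sum_range_succ, add_mul, add_comm]
    exact (norm_add_le _ _).trans (add_le_add hih hstep)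

end CharFun

/-! ### The weight process as a martingale -/

section Model

variable {Ω : Type*} {d : ℕ} {ϑ : Fin d → ℝ} {α : ℕ → ℝ} {g₀ : Fin d → ℝ} {Y : ℕ → Ω → ℕ}

lemma measurable_observed {k n : ℕ} (h1 : 1 ≤ k) (hk : k ≤ n) : Measurable[observed Y n] (Y k) :=
  Measurable.mono (comap_measurable (Y k))
    (le_iSup₂_of_le (f := fun k (_ : k ∈ Finset.Icc 1 n) => MeasurableSpace.comap (Y k) ⊤) k
      (Finset.mem_Icc.2 ⟨h1, hk⟩) le_rfl) le_rfl

lemma newton_congr {y y' : ℕ → ℕ} (n : ℕ) (h : ∀ k, 1 ≤ k → k ≤ n → y k = y' k) :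
    newton ϑ α g₀ y n = newton ϑ α g₀ y' n := by
  induction n with
  | zero => rfl
  | succ n ih =>
    have ih' := ih fun k h1 hk => h k h1 (by omega)
    ext j
    simp only [newton, ih', h (n + 1) (by omega) le_rfl]

/-- The history of the observations is discrete, so every function of the weights up to time `n`
is measurable with respect to it. -/
lemma measurable_comp_newtonProcess {β : Type*} [MeasurableSpace β]
    (f : (Fin d → ℝ) → (Fin d → ℝ) → β) {m n : ℕ} (hmn : m ≤ n) :
    Measurable[observed Y n] fun ω =>
      f (newtonProcess ϑ α g₀ Y m ω) (newtonProcess ϑ α g₀ Y n ω) := by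
  let hist : Ω → Fin n → ℕ := fun ω k => Y (k + 1) ω
  let ext : (Fin n → ℕ) → ℕ → ℕ := fun x k => if h : k - 1 < n then x ⟨k - 1, h⟩ else 0
  have hhist : Measurable[observed Y n] hist :=
    @measurable_pi_lambda Ω (Fin n) (fun _ => ℕ) (observed Y n) _ hist fun _ =>
      measurable_observed (by omega) (by omega)
  have hext : ∀ ω k, 1 ≤ k → k ≤ n → Y k ω = ext (hist ω) k := fun ω k h1 hk => by
    have h : k - 1 < n := by omega
    simp only [ext, hist, dif_pos h, Nat.sub_add_cancel h1]
  have heq : (fun ω => f (newtonProcess ϑ α g₀ Y m ω) (newtonProcess ϑ α g₀ Y n ω))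
      = (fun x => f (newton ϑ α g₀ (ext x) m) (newton ϑ α g₀ (ext x) n)) ∘ hist := by
    funext ω
    simp only [Function.comp, newtonProcess]
    rw [newton_congr m fun k h1 hk => hext ω k h1 (hk.trans hmn),
      newton_congr n fun k h1 hk => hext ω k h1 hk]
  rw [heq]
  exact (Measurable.of_discrete).comp hhist

lemma newtonProcess_succ_sub (n : ℕ) (ω : Ω) (u : Fin d → ℝ) :
    ∑ j, u j * (newtonProcess ϑ α g₀ Y (n + 1) ω j - newtonProcess ϑ α g₀ Y n ω j)
      = α (n + 1) * updateDir ϑ u (newtonProcess ϑ α g₀ Y n ω) (Y (n + 1) ω) := by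
  rw [updateDir, Finset.mul_sum]
  refine Finset.sum_congr rfl fun j _ => ?_
  simp only [newtonProcess, newton]
  ring

lemma measurable_updateDir (u : (Fin d → ℝ) → Fin d → ℝ) {m n : ℕ} (hmn : m ≤ n) (z : ℕ) :
    Measurable[observed Y n] fun ω => updateDir ϑ (u (newtonProcess ϑ α g₀ Y m ω))
      (newtonProcess ϑ α g₀ Y n ω) z :=
  measurable_comp_newtonProcess (fun g h => updateDir ϑ (u g) h z) hmn

variable [mΩ : MeasurableSpace Ω] {P : Measure Ω}

lemma observed_le (hY : ∀ n, 1 ≤ n → Measurable (Y n)) (n : ℕ) : observed Y n ≤ mΩ :=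
  iSup₂_le fun k hk => (hY k (Finset.mem_Icc.1 hk).1).comap_le

/-- The natural filtration of the observations. -/
def observedFiltration (hY : ∀ n, 1 ≤ n → Measurable (Y n)) : Filtration ℕ mΩ where
  seq n := observed Y n
  mono' _ _ h := biSup_mono fun _ hk =>
    Finset.mem_Icc.2 ⟨(Finset.mem_Icc.1 hk).1, (Finset.mem_Icc.1 hk).2.trans h⟩
  le' n := observed_le hY n

namespace LearningModel

lemma newtonProcess_mem (hm : LearningModel P ϑ α g₀ Y) (n : ℕ) (ω : Ω) :
    newtonProcess ϑ α g₀ Y n ω ∈ stdSimplex ℝ (Fin d) :=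
  newton_mem hm.grid_pos hm.rate_mem hm.initial_mem _ n

/-- Integrating out the next observation: given the past, it is distributed according to the
mixture with the current weights. -/
lemma integral_comp_next [IsProbabilityMeasure P] (hm : LearningModel P ϑ α g₀ Y) (n : ℕ)
    {Φ : Ω → ℕ → ℂ} (hΦ : ∀ z, Measurable[observed Y n] fun ω => Φ ω z) {C : ℝ}
    (hC : ∀ ω z, ‖Φ ω z‖ ≤ C) :
    ∫ ω, Φ ω (Y (n + 1) ω) ∂P
      = ∫ ω, ∑' z, (mixture ϑ (newtonProcess ϑ α g₀ Y n ω) z : ℂ) * Φ ω z ∂P := by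
  have hle := observed_le hm.measurable n
  have hYm : Measurable (Y (n + 1)) := hm.measurable (n + 1) (by omega)
  have hΦm : ∀ z, Measurable fun ω => Φ ω z := fun z => (hΦ z).mono hle le_rfl
  have hset : ∀ z, MeasurableSet (Y (n + 1) ⁻¹' {z}) := fun z => hYm (measurableSet_singleton z)
  have hmixm : ∀ z, Measurable fun ω => mixture ϑ (newtonProcess ϑ α g₀ Y n ω) z := fun z =>
    (measurable_comp_newtonProcess (fun _ g => mixture ϑ g z) le_rfl).mono hle le_rfl
  have hbd : ∀ ω z, ‖(mixture ϑ (newtonProcess ϑ α g₀ Y n ω) z : ℂ) * Φ ω z‖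
      ≤ mixture ϑ (newtonProcess ϑ α g₀ Y n ω) z * C := fun ω z => by
    rw [norm_mul, Complex.norm_real, Real.norm_eq_abs,
      abs_of_pos (mixture_pos hm.grid_pos (hm.newtonProcess_mem n ω) z)]
    exact mul_le_mul_of_nonneg_left (hC ω z)
      (mixture_nonneg hm.grid_pos (hm.newtonProcess_mem n ω) z)
  have hmixsum : ∀ ω, HasSum (fun z => mixture ϑ (newtonProcess ϑ α g₀ Y n ω) z * C) C :=
    fun ω => by simpa using (hasSum_mixture (ϑ := ϑ) (hm.newtonProcess_mem n ω)).mul_right C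
  set F : ℕ → Ω → ℂ := fun z ω => (Y (n + 1) ⁻¹' {z}).indicator (fun _ => (1 : ℝ)) ω • Φ ω z
  have hFm : ∀ z, Measurable (F z) := fun z =>
    Measurable.smul (f := (Y (n + 1) ⁻¹' {z}).indicator fun _ => (1 : ℝ))
      (measurable_const.indicator (hset z)) (hΦm z)
  have hFle : ∀ z ω, ‖F z ω‖ ≤ (Y (n + 1) ⁻¹' {z}).indicator (fun _ => C) ω := fun z ω => by
    simp only [F]
    by_cases h : ω ∈ Y (n + 1) ⁻¹' {z}
    · simpa [Set.indicator_of_mem h] using hC ω z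
    · simp [Set.indicator_of_notMem h]
  have hterm : ∀ z, ∫ ω, F z ω ∂P
      = ∫ ω, (mixture ϑ (newtonProcess ϑ α g₀ Y n ω) z : ℂ) * Φ ω z ∂P := fun z => by
    have hind : Integrable ((Y (n + 1) ⁻¹' {z}).indicator (fun _ => (1 : ℝ))) P :=
      (integrable_const _).indicator (hset z)
    have hFi : Integrable
        ((Y (n + 1) ⁻¹' {z}).indicator (fun _ => (1 : ℝ)) • fun ω => Φ ω z) P := by
      refine integrable_of_measurable_of_bound (hFm z) C fun ω => (hFle z ω).trans ?_
      refine Set.indicator_le_self' (fun _ _ => (norm_nonneg _).trans (hC ω 0)) ω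
    have hpull := condExp_smul_of_aestronglyMeasurable_right hind hFi
      (hΦ z).aestronglyMeasurable
    calc ∫ ω, F z ω ∂P
        = ∫ ω, (P[(Y (n + 1) ⁻¹' {z}).indicator (fun _ => (1 : ℝ)) • fun ω => Φ ω z
            | observed Y n]) ω ∂P := (integral_condExp hle).symm
      _ = _ := integral_congr_ae ?_
    filter_upwards [hpull, hm.predictive n z] with ω h1 h2
    rw [h1, Pi.smul_apply', h2, Complex.real_smul]
  have hsum1 : HasSum (fun z => ∫ ω, F z ω ∂P) (∫ ω, Φ ω (Y (n + 1) ω) ∂P) := by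
    have hbs : ∀ ω, HasSum (fun z => (Y (n + 1) ⁻¹' {z}).indicator (fun _ => C) ω) C := fun ω => by
      have := hasSum_single (f := fun z => (Y (n + 1) ⁻¹' {z}).indicator (fun _ => C) ω)
        (Y (n + 1) ω) fun z hz => Set.indicator_of_notMem (fun h => hz (by simpa using h.symm)) _
      simpa using this
    refine hasSum_integral_of_dominated_convergence
      (fun z ω => (Y (n + 1) ⁻¹' {z}).indicator (fun _ => C) ω)
      (fun z => (hFm z).aestronglyMeasurable) (fun z => Eventually.of_forall (hFle z))
      (Eventually.of_forall fun ω => (hbs ω).summable) ?_ (Eventually.of_forall fun ω => ?_)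
    · simp_rw [fun ω => (hbs ω).tsum_eq]
      exact integrable_const C
    · have := hasSum_single (f := fun z => F z ω) (Y (n + 1) ω) fun z hz => by
        simp only [F]
        rw [Set.indicator_of_notMem (fun h => hz (by simpa using h.symm)), zero_smul]
      simpa [F] using this
  have hsum2 : HasSum (fun z => ∫ ω, (mixture ϑ (newtonProcess ϑ α g₀ Y n ω) z : ℂ) * Φ ω z ∂P)
      (∫ ω, ∑' z, (mixture ϑ (newtonProcess ϑ α g₀ Y n ω) z : ℂ) * Φ ω z ∂P) := by
    refine hasSum_integral_of_dominated_convergence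
      (fun z ω => mixture ϑ (newtonProcess ϑ α g₀ Y n ω) z * C)
      (fun z => ((Complex.measurable_ofReal.comp (hmixm z)).mul (hΦm z)).aestronglyMeasurable)
      (fun z => Eventually.of_forall fun ω => hbd ω z)
      (Eventually.of_forall fun ω => (hmixsum ω).summable) ?_ (Eventually.of_forall fun ω => ?_)
    · simp_rw [fun ω => (hmixsum ω).tsum_eq]
      exact integrable_const C
    · exact ((hmixsum ω).summable.of_norm_bounded (hbd ω)).hasSum
  simp_rw [hterm] at hsum1
  exact hsum1.unique hsum2

variable {u : (Fin d → ℝ) → Fin d → ℝ} {U : ℝ}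

lemma abs_increment_le (hm : LearningModel P ϑ α g₀ Y)
    (hu : ∀ g ∈ stdSimplex ℝ (Fin d), ∀ j, |u g j| ≤ U) (m n : ℕ) (ω : Ω) :
    |∑ j, u (newtonProcess ϑ α g₀ Y m ω) j *
        (newtonProcess ϑ α g₀ Y (n + 1) ω j - newtonProcess ϑ α g₀ Y n ω j)|
      ≤ 2 * U * α (n + 1) := by
  have hα := (hm.rate_mem (n + 1) (by omega)).1
  rw [newtonProcess_succ_sub, abs_mul, abs_of_pos hα, mul_comm]
  exact mul_le_mul_of_nonneg_right (abs_updateDir_le hm.grid_pos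
    (hu _ (hm.newtonProcess_mem m ω)) (hm.newtonProcess_mem n ω) _) hα.le

/-- The increments of the weights along a direction chosen in the past have conditional mean
zero. -/
lemma integral_mul_increment [IsProbabilityMeasure P] (hm : LearningModel P ϑ α g₀ Y)
    (hu : ∀ g ∈ stdSimplex ℝ (Fin d), ∀ j, |u g j| ≤ U) {m n : ℕ} (hmn : m ≤ n)
    {H : Ω → ℂ} (hH : Measurable[observed Y n] H) (hH1 : ∀ ω, ‖H ω‖ ≤ 1) :
    ∫ ω, H ω * ((∑ j, u (newtonProcess ϑ α g₀ Y m ω) j *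
        (newtonProcess ϑ α g₀ Y (n + 1) ω j - newtonProcess ϑ α g₀ Y n ω j) : ℝ) : ℂ) ∂P = 0 := by
  have hα := (hm.rate_mem (n + 1) (by omega)).1
  simp_rw [newtonProcess_succ_sub]
  rw [hm.integral_comp_next n (C := 1 * (α (n + 1) * (2 * U))) (Φ := fun ω z => H ω *
    ((α (n + 1) * updateDir ϑ (u (newtonProcess ϑ α g₀ Y m ω))
      (newtonProcess ϑ α g₀ Y n ω) z : ℝ) : ℂ))]
  · refine integral_eq_zero_of_ae (Eventually.of_forall fun ω => ?_)
    have h := (Complex.hasSum_ofReal.2 (hasSum_mixture_mul_updateDir hm.grid_pos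
      (u (newtonProcess ϑ α g₀ Y m ω)) (hm.newtonProcess_mem n ω))).mul_left (H ω * α (n + 1))
    rw [Complex.ofReal_zero, mul_zero] at h
    refine Eq.trans (tsum_congr fun z => ?_) h.tsum_eq
    push_cast
    ring
  · intro z
    exact hH.mul (Complex.measurable_ofReal.comp ((measurable_updateDir u hmn z).const_mul _))
  · intro ω z
    rw [norm_mul, Complex.norm_real, Real.norm_eq_abs, abs_mul, abs_of_pos hα]
    refine mul_le_mul (hH1 ω) (mul_le_mul_of_nonneg_left ?_ hα.le) (by positivity) zero_le_one
    exact abs_updateDir_le hm.grid_pos (hu _ (hm.newtonProcess_mem m ω))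
      (hm.newtonProcess_mem n ω) _

/-- The conditional variance of the increments of the weights along a direction chosen in the
past. -/
lemma integral_mul_increment_sq [IsProbabilityMeasure P] (hm : LearningModel P ϑ α g₀ Y)
    (hu : ∀ g ∈ stdSimplex ℝ (Fin d), ∀ j, |u g j| ≤ U) {m n : ℕ} (hmn : m ≤ n)
    {H : Ω → ℂ} (hH : Measurable[observed Y n] H) (hH1 : ∀ ω, ‖H ω‖ ≤ 1) :
    ∫ ω, H ω * (((∑ j, u (newtonProcess ϑ α g₀ Y m ω) j *
        (newtonProcess ϑ α g₀ Y (n + 1) ω j - newtonProcess ϑ α g₀ Y n ω j)) ^ 2 : ℝ) : ℂ) ∂P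
      = ∫ ω, H ω * ((α (n + 1) ^ 2 * dirVar ϑ (u (newtonProcess ϑ α g₀ Y m ω))
          (newtonProcess ϑ α g₀ Y n ω) : ℝ) : ℂ) ∂P := by
  have hα := (hm.rate_mem (n + 1) (by omega)).1
  simp_rw [newtonProcess_succ_sub]
  rw [hm.integral_comp_next n (C := 1 * (α (n + 1) * (2 * U)) ^ 2) (Φ := fun ω z => H ω *
    (((α (n + 1) * updateDir ϑ (u (newtonProcess ϑ α g₀ Y m ω))
      (newtonProcess ϑ α g₀ Y n ω) z) ^ 2 : ℝ) : ℂ))]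
  · refine integral_congr_ae (Eventually.of_forall fun ω => ?_)
    have h := (Complex.hasSum_ofReal.2 (hasSum_dirVar hm.grid_pos
      (hu _ (hm.newtonProcess_mem m ω)) (hm.newtonProcess_mem n ω))).mul_left
      (H ω * α (n + 1) ^ 2)
    refine Eq.trans (Eq.trans (tsum_congr fun z => ?_) h.tsum_eq) ?_
    · push_cast
      ring
    · push_cast
      ring
  · intro z
    exact hH.mul (Complex.measurable_ofReal.comp
      (((measurable_updateDir u hmn z).const_mul _).pow_const 2))
  · intro ω z
    rw [norm_mul, Complex.norm_real, Real.norm_eq_abs, abs_pow, abs_mul, abs_of_pos hα]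
    refine mul_le_mul (hH1 ω) (pow_le_pow_left₀ (by positivity)
      (mul_le_mul_of_nonneg_left ?_ hα.le) 2) (by positivity) zero_le_one
    exact abs_updateDir_le hm.grid_pos (hu _ (hm.newtonProcess_mem m ω))
      (hm.newtonProcess_mem n ω) _

lemma weight_mem_Icc (hm : LearningModel P ϑ α g₀ Y) (n : ℕ) (ω : Ω) (j : Fin d) :
    newtonProcess ϑ α g₀ Y n ω j ∈ Set.Icc (0 : ℝ) 1 := by
  have h := hm.newtonProcess_mem n ω
  refine ⟨h.1 j, ?_⟩
  rw [← h.2]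
  exact Finset.single_le_sum (fun i _ => h.1 i) (Finset.mem_univ j)

lemma measurable_weight (hm : LearningModel P ϑ α g₀ Y) (n : ℕ) (j : Fin d) :
    Measurable fun ω => newtonProcess ϑ α g₀ Y n ω j :=
  (measurable_comp_newtonProcess (fun _ g => g j) le_rfl).mono (observed_le hm.measurable n) le_rfl

/-- Real-valued coordinate form of `integral_mul_increment`. -/
lemma integral_mul_weight_sub [IsProbabilityMeasure P] (hm : LearningModel P ϑ α g₀ Y) {n : ℕ}
    (j : Fin d) {H : Ω → ℝ} (hH : Measurable[observed Y n] H) (hH1 : ∀ ω, |H ω| ≤ 1) :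
    ∫ ω, H ω * (newtonProcess ϑ α g₀ Y (n + 1) ω j - newtonProcess ϑ α g₀ Y n ω j) ∂P = 0 := by
  have h := hm.integral_mul_increment (u := fun _ => Pi.single j 1) (U := 1)
    (fun g _ i => by by_cases h : i = j <;> simp [h]) (le_refl n)
    (H := fun ω => (H ω : ℂ)) (Complex.measurable_ofReal.comp hH)
    (fun ω => by simpa [Complex.norm_real] using hH1 ω)
  simp only [Pi.single_apply, ite_mul, one_mul, zero_mul, Finset.sum_ite_eq', Finset.mem_univ,
    if_true, ← Complex.ofReal_mul] at h
  rw [integral_complex_ofReal] at h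
  exact_mod_cast h

lemma martingale_weight [IsProbabilityMeasure P] (hm : LearningModel P ϑ α g₀ Y) (j : Fin d) :
    Martingale (fun n ω => newtonProcess ϑ α g₀ Y n ω j) (observedFiltration hm.measurable) P := by
  have hint : ∀ n, Integrable (fun ω => newtonProcess ϑ α g₀ Y n ω j) P := fun n => by
    refine integrable_of_measurable_of_bound (hm.measurable_weight n j) 1 fun ω => ?_
    have := hm.weight_mem_Icc n ω j
    rw [Real.norm_eq_abs, abs_of_nonneg this.1]
    exact this.2
  refine martingale_of_setIntegral_eq_succ (fun n => Measurable.stronglyMeasurable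
    (measurable_comp_newtonProcess (fun _ g => g j) le_rfl)) hint fun n s hs => ?_
  have hs' : MeasurableSet s := observed_le hm.measurable n s hs
  have h := hm.integral_mul_weight_sub (n := n) j (H := s.indicator fun _ => 1)
    (measurable_const.indicator hs) (fun ω => by by_cases h : ω ∈ s <;> simp [h])
  have h2 : ∫ ω in s, (newtonProcess ϑ α g₀ Y (n + 1) ω j - newtonProcess ϑ α g₀ Y n ω j) ∂P
      = 0 := by
    rw [← integral_indicator hs', ← h]
    refine integral_congr_ae (Eventually.of_forall fun ω => ?_)
    by_cases h : ω ∈ s <;> simp [h]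
  rw [integral_sub (hint _).integrableOn (hint _).integrableOn] at h2
  linarith

/-- Bounded martingales converge, so the weights have an almost sure limit. -/
lemma exists_isRandomLimit [IsProbabilityMeasure P] (hm : LearningModel P ϑ α g₀ Y) :
    ∃ gt : Ω → Fin d → ℝ, IsRandomLimit P (newtonProcess ϑ α g₀ Y) gt := by
  have hconv : ∀ j, ∀ᵐ ω ∂P, ∃ c, Tendsto (fun n => newtonProcess ϑ α g₀ Y n ω j) atTop (𝓝 c) :=
    fun j => (hm.martingale_weight j).submartingale.exists_ae_tendsto_of_bdd (R := 1) fun n => by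
      refine (eLpNorm_le_of_ae_bound (C := 1) (Eventually.of_forall fun ω => ?_)).trans ?_
      · have := hm.weight_mem_Icc n ω j
        rw [Real.norm_eq_abs, abs_of_nonneg this.1]
        exact this.2
      · simp
  have hall : ∀ᵐ ω ∂P, ∃ c, Tendsto (fun n => newtonProcess ϑ α g₀ Y n ω) atTop (𝓝 c) := by
    filter_upwards [ae_all_iff.2 hconv] with ω h
    choose c hc using h
    exact ⟨c, tendsto_pi_nhds.2 hc⟩
  obtain ⟨gl, hgl, hlim⟩ := measurable_limit_of_tendsto_metrizable_ae
    (fun n => (measurable_pi_lambda _ fun j => hm.measurable_weight n j).aemeasurable) hall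
  have hS : MeasurableSet (gl ⁻¹' stdSimplex ℝ (Fin d)) :=
    hgl (isClosed_stdSimplex ℝ (Fin d)).measurableSet
  classical
  -- off a null set the limit lies in the simplex; elsewhere it is replaced by `g₀`
  refine ⟨fun ω => if ω ∈ gl ⁻¹' stdSimplex ℝ (Fin d) then gl ω else g₀,
    Measurable.ite hS hgl measurable_const, fun ω => ?_, ?_⟩
  · split_ifs with h
    · exact h
    · exact hm.initial_mem
  · filter_upwards [hlim] with ω h
    have hmem : ω ∈ gl ⁻¹' stdSimplex ℝ (Fin d) :=
      (isClosed_stdSimplex ℝ (Fin d)).mem_of_tendsto h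
        (Eventually.of_forall fun n => hm.newtonProcess_mem n ω)
    rwa [if_pos hmem]

lemma abs_weight_succ_sub_le (hm : LearningModel P ϑ α g₀ Y) (n : ℕ) (ω : Ω) (j : Fin d) :
    |(newtonProcess ϑ α g₀ Y (n + 1) ω) j - newtonProcess ϑ α g₀ Y n ω j| ≤ α (n + 1) := by
  have hα := (hm.rate_mem (n + 1) (by omega)).1
  have hg := hm.weight_mem_Icc n ω j
  have hp := postWeight_mem hm.grid_pos (hm.newtonProcess_mem n ω) (Y (n + 1) ω)
  have hp1 : postWeight ϑ (newtonProcess ϑ α g₀ Y n ω) (Y (n + 1) ω) j ≤ 1 := by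
    rw [← hp.2]
    exact Finset.single_le_sum (fun i _ => hp.1 i) (Finset.mem_univ j)
  have hp0 := hp.1 j
  have e : newtonProcess ϑ α g₀ Y (n + 1) ω j - newtonProcess ϑ α g₀ Y n ω j
      = α (n + 1) * (postWeight ϑ (newtonProcess ϑ α g₀ Y n ω) (Y (n + 1) ω) j
          - newtonProcess ϑ α g₀ Y n ω j) := by
    simp only [newtonProcess, newton]
    ring
  rw [e, abs_mul, abs_of_pos hα]
  refine mul_le_of_le_one_right hα.le (abs_le.2 ⟨?_, ?_⟩) <;> linarith [hg.1, hg.2]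

/-- Orthogonality of the increments bounds the conditional mean square displacement. -/
lemma setIntegral_weight_sub_sq_le [IsProbabilityMeasure P] (hm : LearningModel P ϑ α g₀ Y) (n : ℕ)
    {A : Set Ω} (hA : MeasurableSet[observed Y n] A) (j : Fin d) (r : ℕ) :
    ∫ ω in A, (newtonProcess ϑ α g₀ Y (n + r) ω j - newtonProcess ϑ α g₀ Y n ω j) ^ 2 ∂P
      ≤ (∑ i ∈ Finset.range r, α (n + i + 1) ^ 2) * P.real A := by
  have hA' : MeasurableSet A := observed_le hm.measurable n A hA
  have hbd : ∀ k l ω, |(newtonProcess ϑ α g₀ Y k ω) j - newtonProcess ϑ α g₀ Y l ω j| ≤ 1 :=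
    fun k l ω => by
      have h1 := hm.weight_mem_Icc k ω j
      have h2 := hm.weight_mem_Icc l ω j
      rw [abs_le]
      constructor <;> linarith [h1.1, h1.2, h2.1, h2.2]
  induction r with
  | zero => simp
  | succ r ih =>
    set x : Ω → ℝ := fun ω => newtonProcess ϑ α g₀ Y (n + r) ω j - newtonProcess ϑ α g₀ Y n ω j
      with hx
    set Δ : Ω → ℝ := fun ω =>
      newtonProcess ϑ α g₀ Y (n + r + 1) ω j - newtonProcess ϑ α g₀ Y (n + r) ω j with hΔ
    have hxm : Measurable x := (hm.measurable_weight _ j).sub (hm.measurable_weight _ j)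
    have hΔm : Measurable Δ := (hm.measurable_weight _ j).sub (hm.measurable_weight _ j)
    have hcross : ∫ ω in A, x ω * Δ ω ∂P = 0 := by
      have hmx : Measurable[observed Y (n + r)] x :=
        measurable_comp_newtonProcess (fun g h => h j - g j) (Nat.le_add_right n r)
      have hAr : MeasurableSet[observed Y (n + r)] A :=
        (observedFiltration hm.measurable).mono (Nat.le_add_right n r) A hA
      have h := hm.integral_mul_weight_sub (n := n + r) j (H := A.indicator x)
        (hmx.indicator hAr) (fun ω => by
          by_cases h : ω ∈ A
          · simpa [h] using hbd (n + r) n ω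
          · simp [h])
      rw [← integral_indicator hA', ← h]
      refine integral_congr_ae (Eventually.of_forall fun ω => ?_)
      by_cases h : ω ∈ A <;> simp [h, hΔ]
    have e : ∀ ω, (newtonProcess ϑ α g₀ Y (n + (r + 1)) ω j - newtonProcess ϑ α g₀ Y n ω j) ^ 2
        = x ω ^ 2 + 2 * (x ω * Δ ω) + Δ ω ^ 2 := fun ω => by
      rw [← Nat.add_assoc]; simp only [hx, hΔ]; ring
    have hΔle : ∀ ω, Δ ω ^ 2 ≤ α (n + r + 1) ^ 2 := fun ω =>
      sq_le_sq' (by linarith [abs_le.1 (hm.abs_weight_succ_sub_le (n + r) ω j)])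
        (abs_le.1 (hm.abs_weight_succ_sub_le (n + r) ω j)).2
    have i1 : Integrable (fun ω => x ω ^ 2) (P.restrict A) :=
      integrable_of_measurable_of_bound (hxm.pow_const 2) 1 fun ω => by
        rw [norm_pow]; exact pow_le_one₀ (norm_nonneg _) (hbd _ _ ω)
    have i2 : Integrable (fun ω => 2 * (x ω * Δ ω)) (P.restrict A) :=
      (integrable_of_measurable_of_bound (hxm.mul hΔm) 1 fun ω => by
        rw [Pi.mul_apply, norm_mul]
        exact mul_le_one₀ (hbd _ _ ω) (norm_nonneg _) (hbd _ _ ω)).const_mul 2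
    have i3 : Integrable (fun ω => Δ ω ^ 2) (P.restrict A) :=
      integrable_of_measurable_of_bound (hΔm.pow_const 2) 1 fun ω => by
        rw [norm_pow]; exact pow_le_one₀ (norm_nonneg _) (hbd _ _ ω)
    have i12 : Integrable (fun ω => x ω ^ 2 + 2 * (x ω * Δ ω)) (P.restrict A) := i1.add i2
    have h3 : ∫ ω in A, Δ ω ^ 2 ∂P ≤ α (n + r + 1) ^ 2 * P.real A := by
      refine (integral_mono i3 (integrable_const _) hΔle).trans_eq ?_
      simp [mul_comm]
    simp_rw [e]
    rw [integral_add i12 i3, integral_add i1 i2, integral_const_mul, hcross,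
      Finset.sum_range_succ, add_mul]
    linarith

end LearningModel

end Model

/-! ### Tails of the squared learning rates -/

namespace LearningModel

section Tail

variable {Ω : Type*} [mΩ : MeasurableSpace Ω] {P : Measure Ω} {d : ℕ} {ϑ : Fin d → ℝ}
  {α : ℕ → ℝ} {g₀ : Fin d → ℝ} {Y : ℕ → Ω → ℕ}

lemma summable_tail (hm : LearningModel P ϑ α g₀ Y) {n : ℕ} (hn : 1 ≤ n) :
    Summable fun k => α (n + k) ^ 2 := by
  have h := (summable_nat_add_iff (n - 1)).2 hm.rate_sq_summable
  refine h.congr fun k => ?_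
  congr 2
  omega

lemma tailSq_eq (hm : LearningModel P ϑ α g₀ Y) {n : ℕ} (hn : 1 ≤ n) :
    tailSq α n = α n ^ 2 + tailSq α (n + 1) := by
  unfold tailSq
  rw [(hm.summable_tail hn).tsum_eq_zero_add]
  congr 1
  exact tsum_congr fun k => by congr 2; omega

lemma tailSq_nonneg (n : ℕ) : 0 ≤ tailSq α n := tsum_nonneg fun _ => sq_nonneg _

lemma tailSq_pos (hm : LearningModel P ϑ α g₀ Y) {n : ℕ} (hn : 1 ≤ n) : 0 < tailSq α n := by
  rw [hm.tailSq_eq hn]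
  have := (hm.rate_mem n hn).1
  have := tailSq_nonneg (α := α) (n + 1)
  positivity

lemma rate_pos (hm : LearningModel P ϑ α g₀ Y) {n : ℕ} (hn : 1 ≤ n) : 0 < rate α n :=
  inv_pos.2 (hm.tailSq_pos hn)

lemma tendsto_sum_tailSq (hm : LearningModel P ϑ α g₀ Y) (n : ℕ) :
    Tendsto (fun R => ∑ r ∈ Finset.range R, α (n + r + 1) ^ 2) atTop (𝓝 (tailSq α (n + 1))) := by
  have h := (hm.summable_tail (n := n + 1) (by omega)).hasSum.tendsto_sum_nat
  refine h.congr fun R => Finset.sum_congr rfl fun r _ => ?_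
  congr 2
  omega

lemma sum_sq_le_tailSq (hm : LearningModel P ϑ α g₀ Y) {n : ℕ} (hn : 1 ≤ n) (R : ℕ) :
    ∑ r ∈ Finset.range R, α (n + r + 1) ^ 2 ≤ tailSq α n := by
  have h := (hm.summable_tail (n := n + 1) (by omega)).sum_le_tsum (Finset.range R)
    fun _ _ => sq_nonneg _
  rw [hm.tailSq_eq hn]
  have e : ∑ r ∈ Finset.range R, α (n + r + 1) ^ 2 = ∑ r ∈ Finset.range R, α (n + 1 + r) ^ 2 :=
    Finset.sum_congr rfl fun r _ => by congr 2; omega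
  rw [e]
  exact h.trans (le_add_of_nonneg_left (sq_nonneg _))

lemma tendsto_tailSq : Tendsto (tailSq α) atTop (𝓝 0) := by
  refine (tendsto_add_atTop_iff_nat 1).1 ?_
  refine (tendsto_sum_nat_add fun n => α (n + 1) ^ 2).congr fun n => ?_
  unfold tailSq
  exact tsum_congr fun k => by congr 2; omega

/-- Square summability of `b_n α_n²` forces `b_n α_n² → 0`. -/
lemma tendsto_sq_div_tailSq
    (hsum : Summable fun n : ℕ => (α (n + 1) ^ 2 / tailSq α (n + 1)) ^ 2) :
    Tendsto (fun n => α n ^ 2 / tailSq α n) atTop (𝓝 0) := by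
  refine (tendsto_add_atTop_iff_nat 1).1 ?_
  have h := (Real.continuous_sqrt.tendsto 0).comp hsum.tendsto_atTop_zero
  rw [Real.sqrt_zero] at h
  exact h.congr fun n => Real.sqrt_sq (div_nonneg (sq_nonneg _) (tailSq_nonneg _))

/-! ### The conditional characteristic function of the estimation error -/

variable {u : (Fin d → ℝ) → Fin d → ℝ} {U : ℝ}

lemma integrable_weight_sub_sq [IsFiniteMeasure P] (hm : LearningModel P ϑ α g₀ Y) (A : Set Ω)
    (n r : ℕ) (j : Fin d) :
    Integrable (fun ω => (newtonProcess ϑ α g₀ Y (n + r) ω j - newtonProcess ϑ α g₀ Y n ω j) ^ 2)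
      (P.restrict A) := by
  refine integrable_of_measurable_of_bound
    (((hm.measurable_weight _ j).sub (hm.measurable_weight _ j)).pow_const 2) 1 fun ω => ?_
  have h1 := hm.weight_mem_Icc (n + r) ω j
  have h2 := hm.weight_mem_Icc n ω j
  rw [norm_pow, Real.norm_eq_abs]
  refine pow_le_one₀ (abs_nonneg _) (abs_le.2 ⟨?_, ?_⟩) <;> linarith [h1.1, h1.2, h2.1, h2.2]

/-- A mean displacement bound, from the mean square one by `2 |x| ≤ x² / √τ + √τ` with
`τ = tailSq α n`. -/
lemma setIntegral_sum_abs_weight_sub_le [IsProbabilityMeasure P] (hm : LearningModel P ϑ α g₀ Y)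
    {n : ℕ} (hn : 1 ≤ n) {A : Set Ω} (hA : MeasurableSet[observed Y n] A) (r : ℕ) :
    ∫ ω in A, ∑ j, |(newtonProcess ϑ α g₀ Y (n + r) ω) j - newtonProcess ϑ α g₀ Y n ω j| ∂P
      ≤ d * √(tailSq α n) * P.real A := by
  set τ := tailSq α n
  have hτ : 0 < τ := hm.tailSq_pos hn
  have hsτ : 0 < √τ := Real.sqrt_pos.2 hτ
  have hi := hm.integrable_weight_sub_sq A n r
  have hi' : ∀ j, Integrable (fun ω => (newtonProcess ϑ α g₀ Y (n + r) ω j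
      - newtonProcess ϑ α g₀ Y n ω j) ^ 2 / (2 * √τ) + √τ / 2) (P.restrict A) := fun j =>
    ((hi j).div_const _).add (integrable_const _)
  have hle : ∀ ω, ∑ j, |(newtonProcess ϑ α g₀ Y (n + r) ω) j - newtonProcess ϑ α g₀ Y n ω j|
      ≤ ∑ j, ((newtonProcess ϑ α g₀ Y (n + r) ω j - newtonProcess ϑ α g₀ Y n ω j) ^ 2 / (2 * √τ)
        + √τ / 2) := fun ω => by
    refine Finset.sum_le_sum fun j _ => ?_
    rw [div_add_div _ _ (by positivity) two_ne_zero, le_div_iff₀ (by positivity)]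
    nlinarith [sq_nonneg (|(newtonProcess ϑ α g₀ Y (n + r) ω) j - newtonProcess ϑ α g₀ Y n ω j|
      - √τ), sq_abs (newtonProcess ϑ α g₀ Y (n + r) ω j - newtonProcess ϑ α g₀ Y n ω j)]
  refine (integral_mono_of_nonneg (Eventually.of_forall fun ω =>
    Finset.sum_nonneg fun j _ => abs_nonneg _) (integrable_finsetSum _ fun j _ => hi' j)
    (Eventually.of_forall hle)).trans ?_
  rw [integral_finsetSum _ fun j _ => hi' j]
  have hj : ∀ j ∈ Finset.univ, ∫ ω in A, ((newtonProcess ϑ α g₀ Y (n + r) ω j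
      - newtonProcess ϑ α g₀ Y n ω j) ^ 2 / (2 * √τ) + √τ / 2) ∂P ≤ √τ * P.real A := fun j _ => by
    rw [integral_add ((hi j).div_const _) (integrable_const _), integral_div, integral_const,
      smul_eq_mul, measureReal_restrict_apply_univ]
    have h1 : ∫ ω in A, (newtonProcess ϑ α g₀ Y (n + r) ω j
        - newtonProcess ϑ α g₀ Y n ω j) ^ 2 ∂P ≤ τ * P.real A :=
      (hm.setIntegral_weight_sub_sq_le n hA j r).trans
        (mul_le_mul_of_nonneg_right (hm.sum_sq_le_tailSq hn r) measureReal_nonneg)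
    have h2 : τ * P.real A / (2 * √τ) = √τ / 2 * P.real A := by
      rw [div_eq_iff (by positivity)]
      linear_combination -P.real A * Real.mul_self_sqrt hτ.le
    have h3 := div_le_div_of_nonneg_right h1 (by positivity : 0 ≤ 2 * √τ)
    rw [h2] at h3
    linarith
  refine (Finset.sum_le_sum hj).trans_eq ?_
  rw [Finset.sum_const, Finset.card_univ, Fintype.card_fin, nsmul_eq_mul]
  ring

/-- The constant in the error of the conditional characteristic function of the linearized
estimation error; `ρ` stands for `α_n² b_n` and `τ` for `1 / b_n`. -/
noncomputable def charFunErr (d : ℕ) (U t ρ τ : ℝ) : ℝ :=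
  8 * U ^ 3 * |t| * √ρ * Real.exp (2 * U * |t| * √ρ) + 8 * U ^ 2 * d * √τ + 2 * U ^ 4 * t ^ 2 * ρ

/-- The quantitative central limit theorem for the martingale `⟨u(g_n), g_{n+r} - g_n⟩`, `r ≥ 0`, on
an event of the past up to time `n`. -/
lemma norm_setIntegral_exp_increments_sub_le [IsProbabilityMeasure P]
    (hm : LearningModel P ϑ α g₀ Y) (hmono : AntitoneOn α (Set.Ici 1)) (hU : 0 ≤ U)
    (hu : ∀ g ∈ stdSimplex ℝ (Fin d), ∀ j, |u g j| ≤ U) {n : ℕ} (hn : 1 ≤ n) {A : Set Ω}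
    (hA : MeasurableSet[observed Y n] A) (t : ℝ) (R : ℕ) :
    ‖∫ ω in A, (Complex.exp (Complex.I * ((t * √(rate α n) * ∑ j, u (newtonProcess ϑ α g₀ Y n ω) j *
          (newtonProcess ϑ α g₀ Y (n + R) ω j - newtonProcess ϑ α g₀ Y n ω j) : ℝ) : ℂ))
        - (Real.exp (-((t * √(rate α n)) ^ 2 / 2 * dirVar ϑ (u (newtonProcess ϑ α g₀ Y n ω))
          (newtonProcess ϑ α g₀ Y n ω) * ∑ r ∈ Finset.range R, α (n + r + 1) ^ 2)) : ℂ)) ∂P‖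
      ≤ charFunErr d U t (α n ^ 2 / tailSq α n) (tailSq α n) * t ^ 2 * P.real A := by
  set τ := tailSq α n with hτdef
  set s := t * √(rate α n) with hs
  set ρ := α n ^ 2 / τ with hρ
  have hτ : 0 < τ := hm.tailSq_pos hn
  have hαn := (hm.rate_mem n hn).1
  have hρ0 : 0 ≤ ρ := by positivity
  have hαpos : ∀ r, 0 < α (n + r + 1) := fun r => (hm.rate_mem _ (by omega)).1
  have hαle : ∀ r, α (n + r + 1) ≤ α n := fun r =>
    hmono (Set.mem_Ici.2 hn) (Set.mem_Ici.2 (by omega)) (by omega)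
  have hss : s ^ 2 = t ^ 2 / τ := by
    rw [hs, mul_pow, Real.sq_sqrt (hm.rate_pos hn).le, rate, div_eq_mul_inv]
  let ℱ : Filtration ℕ mΩ :=
    { seq := fun r => observed Y (n + r)
      mono' := fun a b h => (observedFiltration hm.measurable).mono (Nat.add_le_add_left h n)
      le' := fun r => observed_le hm.measurable (n + r) }
  have hA' : MeasurableSet A := observed_le hm.measurable n A hA
  have hAr : ∀ r, MeasurableSet[observed Y (n + r)] A := fun r =>
    (observedFiltration hm.measurable).mono (Nat.le_add_right n r) A hA
  -- a test function for the restricted measure is a test function for `P`, times an indicator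
  have hrestr : ∀ (H : Ω → ℂ) (F : Ω → ℂ),
      ∫ ω in A, H ω * F ω ∂P = ∫ ω, A.indicator H ω * F ω ∂P := fun H F => by
    rw [← integral_indicator hA']
    refine integral_congr_ae (Eventually.of_forall fun ω => ?_)
    by_cases h : ω ∈ A <;> simp [h]
  have hind : ∀ (H : Ω → ℂ), (∀ ω, ‖H ω‖ ≤ 1) → ∀ ω, ‖A.indicator H ω‖ ≤ 1 := fun H hH ω =>
    (norm_indicator_le_norm_self H ω).trans (hH ω)
  have hMdiff : ∀ r ω, ∑ j, u (newtonProcess ϑ α g₀ Y n ω) j *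
        (newtonProcess ϑ α g₀ Y (n + (r + 1)) ω j - newtonProcess ϑ α g₀ Y n ω j)
      - ∑ j, u (newtonProcess ϑ α g₀ Y n ω) j *
        (newtonProcess ϑ α g₀ Y (n + r) ω j - newtonProcess ϑ α g₀ Y n ω j)
      = ∑ j, u (newtonProcess ϑ α g₀ Y n ω) j *
        (newtonProcess ϑ α g₀ Y (n + r + 1) ω j - newtonProcess ϑ α g₀ Y (n + r) ω j) :=
    fun r ω => by
      rw [← Finset.sum_sub_distrib, ← Nat.add_assoc]
      exact Finset.sum_congr rfl fun j _ => by ring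
  have key := norm_integral_exp_martingale_sub_le (ν := P.restrict A) ℱ
    (M := fun r ω => ∑ j, u (newtonProcess ϑ α g₀ Y n ω) j *
          (newtonProcess ϑ α g₀ Y (n + r) ω j - newtonProcess ϑ α g₀ Y n ω j))
    (v := fun r ω => dirVar ϑ (u (newtonProcess ϑ α g₀ Y n ω)) (newtonProcess ϑ α g₀ Y (n + r) ω))
    (a := fun r => α (n + r + 1)) (c := 2 * U) (V := 4 * U ^ 2)
    (δ := 16 * U ^ 2 * (d * √τ)) s
    (fun r => measurable_comp_newtonProcess (fun g h => ∑ j, u g j * (h j - g j))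
      (Nat.le_add_right n r))
    (fun ω => by simp)
    (fun r => measurable_comp_newtonProcess (fun g h => dirVar ϑ (u g) h) (Nat.le_add_right n r))
    (fun r ω => dirVar_nonneg hm.grid_pos _ (hm.newtonProcess_mem _ ω))
    (fun r ω => dirVar_le hm.grid_pos (hu _ (hm.newtonProcess_mem n ω)) (hm.newtonProcess_mem _ ω))
    (fun r ω => by
      simp only [hMdiff]
      exact hm.abs_increment_le hu n (n + r) ω)
    (fun r H hH hH1 => by
      simp only [hMdiff]
      rw [hrestr]
      exact hm.integral_mul_increment hu (Nat.le_add_right n r) (hH.indicator (hAr r))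
        (hind H hH1))
    (fun r H hH hH1 => by
      simp only [hMdiff]
      rw [hrestr, hrestr]
      exact hm.integral_mul_increment_sq hu (Nat.le_add_right n r) (hH.indicator (hAr r))
        (hind H hH1))
    (fun r => by
      rw [measureReal_restrict_apply_univ]
      have hgi : Integrable (fun ω => 16 * U ^ 2 * ∑ j, |(newtonProcess ϑ α g₀ Y (n + r) ω) j
          - newtonProcess ϑ α g₀ Y n ω j|) (P.restrict A) := by
        refine Integrable.const_mul (integrable_finsetSum _ fun j _ => ?_) _
        refine integrable_of_measurable_of_bound (C := 1) (measurable_norm.comp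
          ((hm.measurable_weight _ j).sub (hm.measurable_weight _ j))) fun ω => ?_
        have h1 := hm.weight_mem_Icc (n + r) ω j
        have h2 := hm.weight_mem_Icc n ω j
        rw [Real.norm_eq_abs, abs_abs]
        refine abs_le.2 ⟨?_, ?_⟩ <;> linarith [h1.1, h1.2, h2.1, h2.2]
      refine (integral_mono_of_nonneg (Eventually.of_forall fun ω => abs_nonneg _) hgi
        (Eventually.of_forall fun ω => abs_dirVar_sub_le hm.grid_pos
          (hu _ (hm.newtonProcess_mem n ω)) (hm.newtonProcess_mem _ ω)
          (hm.newtonProcess_mem _ ω))).trans ?_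
      rw [integral_const_mul]
      have := hm.setIntegral_sum_abs_weight_sub_le hn hA r
      calc _ ≤ 16 * U ^ 2 * (d * √τ * P.real A) := by gcongr
        _ = _ := by ring)
    R (fun _ => 1) measurable_const (fun ω => by simp)
  simp only [one_mul, measureReal_restrict_apply_univ] at key
  refine key.trans (mul_le_mul_of_nonneg_right ?_ measureReal_nonneg)
  have hsabs : ∀ r, |s| * α (n + r + 1) ≤ |t| * √ρ := fun r => by
    refine (pow_le_pow_iff_left₀ (mul_nonneg (abs_nonneg _) (hαpos r).le) (by positivity)
      two_ne_zero).1 ?_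
    rw [mul_pow, mul_pow, sq_abs, sq_abs, hss, Real.sq_sqrt hρ0, hρ]
    have : α (n + r + 1) ^ 2 ≤ α n ^ 2 := pow_le_pow_left₀ (hαpos r).le (hαle r) 2
    calc t ^ 2 / τ * α (n + r + 1) ^ 2 ≤ t ^ 2 / τ * α n ^ 2 := by gcongr
      _ = _ := by ring
  -- every term is at most a constant multiple of `b_n α_{n+r+1}²`, and these sum to at most `1`
  have hterm : ∀ r ∈ Finset.range R,
      (2 * U * |s| * α (n + r + 1)) ^ 3 * Real.exp (2 * U * |s| * α (n + r + 1))
        + s ^ 2 * α (n + r + 1) ^ 2 / 2 * (16 * U ^ 2 * (d * √τ))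
        + (s ^ 2 * α (n + r + 1) ^ 2 / 2 * (4 * U ^ 2)) ^ 2 / 2
      ≤ charFunErr d U t ρ τ * (t ^ 2 / τ * α (n + r + 1) ^ 2) := fun r _ => by
    set x := |s| * α (n + r + 1) with hx
    have hx0 : 0 ≤ x := mul_nonneg (abs_nonneg _) (hαpos r).le
    have hxle : x ≤ |t| * √ρ := hsabs r
    have hx2 : s ^ 2 * α (n + r + 1) ^ 2 = x ^ 2 := by rw [hx, mul_pow |s|, sq_abs]
    have e1 : 2 * U * |s| * α (n + r + 1) = 2 * U * x := by rw [hx]; ring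
    rw [e1, hx2, ← hss, hx2, charFunErr]
    have h1 : (2 * U * x) ^ 3 * Real.exp (2 * U * x)
        ≤ 8 * U ^ 3 * |t| * √ρ * Real.exp (2 * U * |t| * √ρ) * x ^ 2 := by
      calc (2 * U * x) ^ 3 * Real.exp (2 * U * x)
          = 8 * U ^ 3 * x ^ 2 * (x * Real.exp (2 * U * x)) := by ring
        _ ≤ 8 * U ^ 3 * x ^ 2 * (|t| * √ρ * Real.exp (2 * U * (|t| * √ρ))) := by gcongr
        _ = _ := by ring_nf
    have h3 : x ^ 2 ≤ t ^ 2 * ρ := by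
      calc x ^ 2 ≤ (|t| * √ρ) ^ 2 := pow_le_pow_left₀ hx0 hxle 2
        _ = _ := by rw [mul_pow, sq_abs, Real.sq_sqrt hρ0]
    have h4 : 2 * U ^ 4 * x ^ 2 * x ^ 2 ≤ 2 * U ^ 4 * (t ^ 2 * ρ) * x ^ 2 := by gcongr
    nlinarith
  refine (Finset.sum_le_sum hterm).trans ?_
  rw [← Finset.mul_sum, ← Finset.mul_sum]
  have hE : 0 ≤ charFunErr d U t ρ τ := by unfold charFunErr; positivity
  refine mul_le_mul_of_nonneg_left ?_ hE
  calc t ^ 2 / τ * ∑ r ∈ Finset.range R, α (n + r + 1) ^ 2 ≤ t ^ 2 / τ * τ :=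
        mul_le_mul_of_nonneg_left (hm.sum_sq_le_tailSq hn R) (by positivity)
    _ = t ^ 2 := by field_simp

lemma norm_cexp_I_mul (x : ℝ) : ‖Complex.exp (Complex.I * (x : ℂ))‖ = 1 := by
  rw [mul_comm]; exact Complex.norm_exp_ofReal_mul_I x

lemma norm_ofReal_exp_neg_le_one {x : ℝ} (hx : 0 ≤ x) : ‖(Real.exp (-x) : ℂ)‖ ≤ 1 := by
  rw [Complex.norm_real, Real.norm_eq_abs, Real.abs_exp]
  exact Real.exp_le_one_iff.2 (by linarith)

/-- The limit `R → ∞` of `norm_setIntegral_exp_increments_sub_le`. -/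
lemma norm_setIntegral_exp_limit_sub_le [IsProbabilityMeasure P]
    (hm : LearningModel P ϑ α g₀ Y) (hmono : AntitoneOn α (Set.Ici 1)) (hU : 0 ≤ U)
    (hu : ∀ g ∈ stdSimplex ℝ (Fin d), ∀ j, |u g j| ≤ U) {n : ℕ} (hn : 1 ≤ n) {A : Set Ω}
    (hA : MeasurableSet[observed Y n] A) {gt : Ω → Fin d → ℝ}
    (hgt : IsRandomLimit P (newtonProcess ϑ α g₀ Y) gt) (t : ℝ) :
    ‖∫ ω in A, (Complex.exp (Complex.I * ((t * √(rate α n) * ∑ j, u (newtonProcess ϑ α g₀ Y n ω) j *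
          (gt ω j - newtonProcess ϑ α g₀ Y n ω j) : ℝ) : ℂ))
        - (Real.exp (-((t * √(rate α n)) ^ 2 / 2 * dirVar ϑ (u (newtonProcess ϑ α g₀ Y n ω))
          (newtonProcess ϑ α g₀ Y n ω) * tailSq α (n + 1))) : ℂ)) ∂P‖
      ≤ charFunErr d U t (α n ^ 2 / tailSq α n) (tailSq α n) * t ^ 2 * P.real A := by
  have hlim := tendsto_sum_tailSq hm n
  have hle := observed_le hm.measurable
  refine le_of_tendsto (x := atTop) (Tendsto.norm ?_) (Eventually.of_forall fun R =>
    hm.norm_setIntegral_exp_increments_sub_le hmono hU hu hn hA t R)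
  refine tendsto_integral_of_dominated_convergence (fun _ => 2) (fun R => ?_) (integrable_const _)
    (fun R => Eventually.of_forall fun ω => ?_) ?_
  · have h1 : Measurable fun ω => Complex.exp (Complex.I * ((t * √(rate α n) *
        ∑ j, u (newtonProcess ϑ α g₀ Y n ω) j *
          (newtonProcess ϑ α g₀ Y (n + R) ω j - newtonProcess ϑ α g₀ Y n ω j) : ℝ) : ℂ))
        - (Real.exp (-((t * √(rate α n)) ^ 2 / 2 * dirVar ϑ (u (newtonProcess ϑ α g₀ Y n ω))
          (newtonProcess ϑ α g₀ Y n ω) * ∑ r ∈ Finset.range R, α (n + r + 1) ^ 2)) : ℂ) :=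
      (measurable_comp_newtonProcess (fun g h => Complex.exp (Complex.I * ((t * √(rate α n) *
        ∑ j, u g j * (h j - g j) : ℝ) : ℂ)) - (Real.exp (-((t * √(rate α n)) ^ 2 / 2 *
          dirVar ϑ (u g) g * ∑ r ∈ Finset.range R, α (n + r + 1) ^ 2)) : ℂ))
        (Nat.le_add_right n R)).mono (hle _) le_rfl
    exact h1.aestronglyMeasurable
  · refine (norm_sub_le _ _).trans ?_
    rw [norm_cexp_I_mul]
    have := norm_ofReal_exp_neg_le_one (mul_nonneg (mul_nonneg
      (by positivity : 0 ≤ (t * √(rate α n)) ^ 2 / 2)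
      (dirVar_nonneg hm.grid_pos (u (newtonProcess ϑ α g₀ Y n ω)) (hm.newtonProcess_mem n ω)))
      (Finset.sum_nonneg fun r (_ : r ∈ Finset.range R) => sq_nonneg (α (n + r + 1))))
    linarith
  · filter_upwards [ae_restrict_of_ae hgt.tendsto] with ω hω
    have hω' : ∀ j, Tendsto (fun R => newtonProcess ϑ α g₀ Y (n + R) ω j) atTop (𝓝 (gt ω j)) :=
      fun j => by
        have := (tendsto_add_atTop_iff_nat n).2 (tendsto_pi_nhds.1 hω j)
        exact this.congr fun R => by rw [Nat.add_comm]
    refine Tendsto.sub ?_ ?_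
    · refine (Complex.continuous_exp.tendsto _).comp (Tendsto.const_mul _ ?_)
      refine (Complex.continuous_ofReal.tendsto _).comp (Tendsto.const_mul _ ?_)
      exact tendsto_finsetSum _ fun j _ => ((hω' j).sub tendsto_const_nhds).const_mul _
    · refine (Complex.continuous_ofReal.tendsto _).comp ((Real.continuous_exp.tendsto _).comp ?_)
      exact (hlim.const_mul _).neg

lemma measurable_limit_weight {g : ℕ → Ω → Fin d → ℝ} {gt : Ω → Fin d → ℝ}
    (hgt : IsRandomLimit P g gt) (j : Fin d) : Measurable fun ω => gt ω j :=
  (measurable_pi_apply j).comp hgt.measurable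

lemma limit_weight_mem_Icc {g : ℕ → Ω → Fin d → ℝ} {gt : Ω → Fin d → ℝ}
    (hgt : IsRandomLimit P g gt) (ω : Ω) (j : Fin d) : gt ω j ∈ Set.Icc (0 : ℝ) 1 := by
  have h := hgt.mem_simplex ω
  refine ⟨h.1 j, ?_⟩
  rw [← h.2]
  exact Finset.single_le_sum (fun i _ => h.1 i) (Finset.mem_univ j)

lemma integrable_limit_sub_sq [IsFiniteMeasure P] (hm : LearningModel P ϑ α g₀ Y)
    {gt : Ω → Fin d → ℝ} (hgt : IsRandomLimit P (newtonProcess ϑ α g₀ Y) gt) (A : Set Ω) (n : ℕ) :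
    Integrable (fun ω => ∑ j, (gt ω j - newtonProcess ϑ α g₀ Y n ω j) ^ 2) (P.restrict A) := by
  refine integrable_finsetSum _ fun j _ => integrable_of_measurable_of_bound
    (((measurable_limit_weight hgt j).sub (hm.measurable_weight n j)).pow_const 2) 1 fun ω => ?_
  have h1 := limit_weight_mem_Icc hgt ω j
  have h2 := hm.weight_mem_Icc n ω j
  rw [norm_pow, Real.norm_eq_abs]
  refine pow_le_one₀ (abs_nonneg _) (abs_le.2 ⟨?_, ?_⟩) <;> linarith [h1.1, h1.2, h2.1, h2.2]

lemma setIntegral_limit_sub_sq_le [IsProbabilityMeasure P] (hm : LearningModel P ϑ α g₀ Y)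
    {gt : Ω → Fin d → ℝ} (hgt : IsRandomLimit P (newtonProcess ϑ α g₀ Y) gt) {n : ℕ} (hn : 1 ≤ n)
    {A : Set Ω} (hA : MeasurableSet[observed Y n] A) :
    ∫ ω in A, ∑ j, (gt ω j - newtonProcess ϑ α g₀ Y n ω j) ^ 2 ∂P
      ≤ d * tailSq α n * P.real A := by
  have hbound : ∀ R, ∫ ω in A, ∑ j, (newtonProcess ϑ α g₀ Y (n + R) ω j
      - newtonProcess ϑ α g₀ Y n ω j) ^ 2 ∂P ≤ d * tailSq α n * P.real A := fun R => by
    rw [integral_finsetSum _ fun j _ => hm.integrable_weight_sub_sq A n R j]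
    refine (Finset.sum_le_sum fun j _ => (hm.setIntegral_weight_sub_sq_le n hA j R).trans
      (mul_le_mul_of_nonneg_right (hm.sum_sq_le_tailSq hn R) measureReal_nonneg)).trans_eq ?_
    rw [Finset.sum_const, Finset.card_univ, Fintype.card_fin, nsmul_eq_mul, mul_assoc]
  refine le_of_tendsto (x := atTop) ?_ (Eventually.of_forall hbound)
  refine tendsto_integral_of_dominated_convergence (fun _ => (d : ℝ))
    (fun R => (integrable_finsetSum _ fun j _ =>
      hm.integrable_weight_sub_sq A n R j).aestronglyMeasurable) (integrable_const _)
    (fun R => Eventually.of_forall fun ω => ?_) ?_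
  · rw [Real.norm_eq_abs, abs_of_nonneg (Finset.sum_nonneg fun j _ => sq_nonneg _)]
    refine (Finset.sum_le_sum fun j _ => (?_ : _ ≤ (1 : ℝ))).trans_eq (by simp)
    have h1 := hm.weight_mem_Icc (n + R) ω j
    have h2 := hm.weight_mem_Icc n ω j
    rw [← sq_abs]
    refine pow_le_one₀ (abs_nonneg _) (abs_le.2 ⟨?_, ?_⟩) <;> linarith [h1.1, h1.2, h2.1, h2.2]
  · filter_upwards [ae_restrict_of_ae hgt.tendsto] with ω hω
    refine tendsto_finsetSum _ fun j _ => (Tendsto.sub ?_ tendsto_const_nhds).pow 2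
    have := (tendsto_add_atTop_iff_nat n).2 (tendsto_pi_nhds.1 hω j)
    exact this.congr fun R => by rw [Nat.add_comm]

end Tail

section Error

variable {Ω : Type*} [mΩ : MeasurableSpace Ω] {P : Measure Ω} {d : ℕ} {ϑ : Fin d → ℝ}
  {α : ℕ → ℝ} {g₀ : Fin d → ℝ} {Y : ℕ → Ω → ℕ}

lemma measurable_comp_limit {f : (Fin d → ℝ) → ℝ} (hf : ContinuousOn f (stdSimplex ℝ (Fin d)))
    {g : ℕ → Ω → Fin d → ℝ} {gt : Ω → Fin d → ℝ} (hgt : IsRandomLimit P g gt) :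
    Measurable fun ω => f (gt ω) :=
  (continuousOn_iff_continuous_domRestrict.1 hf).measurable.comp
    (hgt.measurable.subtype_mk (h := hgt.mem_simplex))

lemma measurable_scaled_error (hm : LearningModel P ϑ α g₀ Y) {gt : Ω → Fin d → ℝ}
    (hgt : IsRandomLimit P (newtonProcess ϑ α g₀ Y) gt) (y n : ℕ) :
    Measurable fun ω => √(rate α n) *
      (estimate ϑ (gt ω) y - estimate ϑ (newtonProcess ϑ α g₀ Y n ω) y) :=
  ((measurable_comp_limit (continuousOn_estimate hm.grid_pos y) hgt).sub
    ((measurable_comp_newtonProcess (fun _ g => estimate ϑ g y) (le_refl n)).mono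
      (observed_le hm.measurable n) le_rfl)).const_mul _

lemma norm_cexp_I_mul_sub_le (a b : ℝ) :
    ‖Complex.exp (Complex.I * (a : ℂ)) - Complex.exp (Complex.I * (b : ℂ))‖ ≤ |a - b| := by
  have e : Complex.exp (Complex.I * (a : ℂ)) - Complex.exp (Complex.I * (b : ℂ))
      = Complex.exp (Complex.I * (b : ℂ)) * (Complex.exp (Complex.I * ((a - b : ℝ) : ℂ)) - 1) := by
    rw [mul_sub, ← Complex.exp_add, mul_one]
    congr 2
    push_cast
    ring
  rw [e, norm_mul, norm_cexp_I_mul, one_mul]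
  exact Real.norm_exp_I_mul_ofReal_sub_one_le

lemma abs_exp_neg_sub_exp_neg_le {a b : ℝ} (ha : 0 ≤ a) (hab : a ≤ b) :
    |Real.exp (-a) - Real.exp (-b)| ≤ b - a := by
  have h1 : Real.exp (-b) ≤ Real.exp (-a) := Real.exp_le_exp.2 (by linarith)
  have h2 : Real.exp (-b) = Real.exp (-a) * Real.exp (-(b - a)) := by
    rw [← Real.exp_add]; congr 1; ring
  have h3 : 1 - (b - a) ≤ Real.exp (-(b - a)) := by linarith [Real.add_one_le_exp (-(b - a))]
  have h4 : Real.exp (-a) ≤ 1 := Real.exp_le_one_iff.2 (by linarith)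
  rw [abs_of_nonneg (by linarith), h2]
  nlinarith [Real.exp_pos (-a)]

/-- On every event of the past, the characteristic function of the scaled estimation error is
close to that of the Gaussian mixture with variance `W_{g_n}`, with a relative error that is
deterministic, continuous in the frequency and vanishing in the limit. -/
lemma exists_charFun_error [IsProbabilityMeasure P] (hm : LearningModel P ϑ α g₀ Y)
    (hmono : AntitoneOn α (Set.Ici 1))
    (hsum : Summable fun n : ℕ => (α (n + 1) ^ 2 / tailSq α (n + 1)) ^ 2) {gt : Ω → Fin d → ℝ}
    (hgt : IsRandomLimit P (newtonProcess ϑ α g₀ Y) gt) (y : ℕ) :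
    ∃ ε : ℕ → ℝ → ℝ, (∀ n, Continuous (ε n)) ∧ (∀ t, Tendsto (fun n => ε n t) atTop (𝓝 0)) ∧
      ∀ n, 1 ≤ n → ∀ A : Set Ω, MeasurableSet[observed Y n] A → ∀ t : ℝ,
        ‖∫ ω in A, (Complex.exp (Complex.I * ((t * (√(rate α n) *
            (estimate ϑ (gt ω) y - estimate ϑ (newtonProcess ϑ α g₀ Y n ω) y)) : ℝ) : ℂ))
          - (Real.exp (-(t ^ 2 / 2 * asympVar ϑ (newtonProcess ϑ α g₀ Y n ω) y)) : ℂ)) ∂P‖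
        ≤ ε n t * P.real A := by
  obtain ⟨U, hU, hu⟩ := exists_abs_estimateGrad_le hm.grid_pos y
  obtain ⟨C, hC, hrem⟩ := exists_abs_estimate_remainder_le hm.grid_pos y
  have hρlim := tendsto_sq_div_tailSq hsum
  have hτlim := tendsto_tailSq (α := α)
  refine ⟨fun n t => charFunErr d U t (α n ^ 2 / tailSq α n) (tailSq α n) * t ^ 2
    + 2 * U ^ 2 * t ^ 2 * (α n ^ 2 / tailSq α n) + |t| * C * d * √(tailSq α n),
    fun n => by unfold charFunErr; fun_prop, fun t => ?_, fun n hn A hA t => ?_⟩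
  · have hc : Continuous fun p : ℝ × ℝ => charFunErr d U t p.1 p.2 * t ^ 2
        + 2 * U ^ 2 * t ^ 2 * p.1 + |t| * C * d * √p.2 := by
      unfold charFunErr; fun_prop
    have h := (hc.tendsto (0, 0)).comp (hρlim.prodMk_nhds hτlim)
    simpa [charFunErr, Function.comp_def] using h
  set τ := tailSq α n with hτdef
  have hτ : 0 < τ := hm.tailSq_pos hn
  set ρ := α n ^ 2 / τ with hρ
  set u : (Fin d → ℝ) → Fin d → ℝ := fun g j => estimateGrad ϑ g y j with hudef
  set X : Ω → ℝ := fun ω => t * (√(rate α n) *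
    (estimate ϑ (gt ω) y - estimate ϑ (newtonProcess ϑ α g₀ Y n ω) y)) with hX
  set L : Ω → ℝ := fun ω => t * √(rate α n) * ∑ j, u (newtonProcess ϑ α g₀ Y n ω) j *
    (gt ω j - newtonProcess ϑ α g₀ Y n ω j) with hL
  set W : Ω → ℝ := fun ω => asympVar ϑ (newtonProcess ϑ α g₀ Y n ω) y with hW
  have hW0 : ∀ ω, 0 ≤ W ω := fun ω => asympVar_nonneg hm.grid_pos (hm.newtonProcess_mem n ω) y
  have hdW : ∀ ω, dirVar ϑ (u (newtonProcess ϑ α g₀ Y n ω)) (newtonProcess ϑ α g₀ Y n ω) = W ω :=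
    fun ω => dirVar_estimateGrad hm.grid_pos (hm.newtonProcess_mem n ω) y
  have hWle : ∀ ω, W ω ≤ 4 * U ^ 2 := fun ω => by
    rw [← hdW ω]
    exact dirVar_le hm.grid_pos (hu _ (hm.newtonProcess_mem n ω)) (hm.newtonProcess_mem n ω)
  have hmeas : ∀ f : (Fin d → ℝ) → ℝ, Measurable fun ω => f (newtonProcess ϑ α g₀ Y n ω) :=
    fun f => (measurable_comp_newtonProcess (fun _ g => f g) (le_refl n)).mono
      (observed_le hm.measurable n) le_rfl
  have hWm : Measurable W := hmeas fun g => asympVar ϑ g y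
  have hXm : Measurable X := (hm.measurable_scaled_error hgt y n).const_mul t
  have hLm : Measurable L := by
    refine Measurable.const_mul (Finset.measurable_sum _ fun j _ => ?_) _
    exact (hmeas fun g => u g j).mul
      ((measurable_limit_weight hgt j).sub (hm.measurable_weight n j))
  have hss : (t * √(rate α n)) ^ 2 = t ^ 2 / τ := by
    rw [mul_pow, Real.sq_sqrt (hm.rate_pos hn).le, rate, div_eq_mul_inv]
  have hmain := hm.norm_setIntegral_exp_limit_sub_le (u := u) hmono hU hu hn hA hgt t
  simp only [hdW, hss] at hmain
  -- linearization error, martingale limit error, and the error from replacing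
  -- `b_n ∑_{k > n} α_k²` by `1`
  set G₁ : Ω → ℂ := fun ω => Complex.exp (Complex.I * (X ω : ℂ))
    - Complex.exp (Complex.I * (L ω : ℂ))
    with hG₁
  set G₂ : Ω → ℂ := fun ω => Complex.exp (Complex.I * (L ω : ℂ))
    - (Real.exp (-(t ^ 2 / τ / 2 * W ω * tailSq α (n + 1))) : ℂ) with hG₂
  set G₃ : Ω → ℂ := fun ω => (Real.exp (-(t ^ 2 / τ / 2 * W ω * tailSq α (n + 1))) : ℂ)
    - (Real.exp (-(t ^ 2 / 2 * W ω)) : ℂ) with hG₃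
  have ht0 := tailSq_nonneg (α := α) (n + 1)
  have hG₁b : ∀ ω, ‖G₁ ω‖ ≤ |t| * √(rate α n) * C *
      ∑ j, (gt ω j - newtonProcess ϑ α g₀ Y n ω j) ^ 2 := fun ω => by
    refine (norm_cexp_I_mul_sub_le _ _).trans ?_
    have e : X ω - L ω = t * √(rate α n) * (estimate ϑ (gt ω) y
        - estimate ϑ (newtonProcess ϑ α g₀ Y n ω) y
        - ∑ j, u (newtonProcess ϑ α g₀ Y n ω) j * (gt ω j - newtonProcess ϑ α g₀ Y n ω j)) := by
      simp only [hX, hL]; ring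
    rw [e, abs_mul, abs_mul, abs_of_nonneg (Real.sqrt_nonneg _), mul_assoc _ C]
    exact mul_le_mul_of_nonneg_left (hrem _ (hm.newtonProcess_mem n ω) _ (hgt.mem_simplex ω))
      (by positivity)
  have hG₃b : ∀ ω, ‖G₃ ω‖ ≤ 2 * U ^ 2 * t ^ 2 * ρ := fun ω => by
    have e : t ^ 2 / τ / 2 * W ω * tailSq α (n + 1) = t ^ 2 / 2 * W ω - t ^ 2 / 2 * W ω * ρ := by
      have h := hm.tailSq_eq hn
      rw [← hτdef] at h
      rw [hρ, show tailSq α (n + 1) = τ - α n ^ 2 by linarith]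
      field_simp
    have hρ0 : 0 ≤ ρ := by positivity
    have hx0 : 0 ≤ t ^ 2 / 2 * W ω * ρ := mul_nonneg (mul_nonneg (by positivity) (hW0 ω)) hρ0
    have h1 := abs_exp_neg_sub_exp_neg_le (a := t ^ 2 / τ / 2 * W ω * tailSq α (n + 1))
      (b := t ^ 2 / 2 * W ω) (mul_nonneg (mul_nonneg (by positivity) (hW0 ω)) ht0)
      (by rw [e]; linarith)
    have h2 : t ^ 2 / 2 * W ω * ρ ≤ t ^ 2 / 2 * (4 * U ^ 2) * ρ := by
      have := hWle ω
      gcongr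
    simp only [hG₃]
    rw [← Complex.ofReal_sub, Complex.norm_real, Real.norm_eq_abs]
    refine h1.trans ?_
    rw [e]
    linarith
  have hone : ∀ ω, ‖(Real.exp (-(t ^ 2 / τ / 2 * W ω * tailSq α (n + 1))) : ℂ)‖ ≤ 1 := fun ω =>
    norm_ofReal_exp_neg_le_one (mul_nonneg (mul_nonneg (by positivity) (hW0 ω)) ht0)
  have i1 : Integrable G₁ (P.restrict A) := by
    refine integrable_of_measurable_of_bound (by fun_prop) 2 fun ω => (norm_sub_le _ _).trans ?_
    rw [norm_cexp_I_mul, norm_cexp_I_mul]; norm_num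
  have i2 : Integrable G₂ (P.restrict A) := by
    refine integrable_of_measurable_of_bound (by fun_prop) 2 fun ω => (norm_sub_le _ _).trans ?_
    rw [norm_cexp_I_mul]; linarith [hone ω]
  have i3 : Integrable G₃ (P.restrict A) :=
    integrable_of_measurable_of_bound (by fun_prop) _ hG₃b
  have e : ∀ ω, Complex.exp (Complex.I * (X ω : ℂ)) - (Real.exp (-(t ^ 2 / 2 * W ω)) : ℂ)
      = G₁ ω + G₂ ω + G₃ ω := fun ω => by simp only [hG₁, hG₂, hG₃]; ring
  have i12 : Integrable (fun ω => G₁ ω + G₂ ω) (P.restrict A) := i1.add i2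
  have n1 : ‖∫ ω in A, G₁ ω ∂P‖ ≤ |t| * C * d * √τ * P.real A := by
    refine (norm_integral_le_of_norm_le ((hm.integrable_limit_sub_sq hgt A n).const_mul _)
      (Eventually.of_forall hG₁b)).trans ?_
    rw [integral_const_mul]
    have hr : √(rate α n) * τ = √τ := by
      rw [rate, Real.sqrt_inv, inv_mul_eq_div, Real.div_sqrt]
    calc |t| * √(rate α n) * C * ∫ ω in A, ∑ j, (gt ω j - newtonProcess ϑ α g₀ Y n ω j) ^ 2 ∂P
        ≤ |t| * √(rate α n) * C * (d * τ * P.real A) :=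
          mul_le_mul_of_nonneg_left (hm.setIntegral_limit_sub_sq_le hgt hn hA) (by positivity)
      _ = |t| * C * d * (√(rate α n) * τ) * P.real A := by ring
      _ = _ := by rw [hr]
  have n3 : ‖∫ ω in A, G₃ ω ∂P‖ ≤ 2 * U ^ 2 * t ^ 2 * ρ * P.real A := by
    refine (norm_integral_le_of_norm_le_const (Eventually.of_forall hG₃b)).trans_eq ?_
    rw [measureReal_restrict_apply_univ]
  rw [integral_congr_ae (Eventually.of_forall e), integral_add i12 i3, integral_add i1 i2]
  refine (norm_add_le _ _).trans ((add_le_add_left (norm_add_le _ _) _).trans ?_)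
  linarith

end Error

end LearningModel

/-! ### Conditional laws -/

section CondLaw

variable {Ω : Type*} {m mΩ : MeasurableSpace Ω} {P : Measure Ω}

/-- Conditional expectations of functions of `X` and of the past are integrals against `condLaw`. -/
lemma condExp_ae_eq_integral_condLaw [IsFiniteMeasure P] (hmle : m ≤ mΩ)
    {E : Type*} [NormedAddCommGroup E] [NormedSpace ℝ E] [CompleteSpace E] {X : Ω → ℝ}
    (hX : Measurable X) {f : Ω × ℝ → E}
    (hf : StronglyMeasurable[@Prod.instMeasurableSpace Ω ℝ m _] f)
    (hint : Integrable (fun ω => f (ω, X ω)) P) :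
    P[fun ω => f (ω, X ω) | m] =ᵐ[P] fun ω => ∫ x, f (ω, x) ∂(condLaw m P X ω) := by
  have h := condExp_prod_ae_eq_integral_condDistrib (mα := mΩ) (mβ := m) (X := (id : Ω → Ω))
    (Y := X) (μ := P) (measurable_id'' hmle) hX.aemeasurable hf hint
  rw [MeasurableSpace.comap_id] at h
  exact h

lemma ae_le_of_forall_setIntegral_le_mul [IsFiniteMeasure P]
    (hmle : m ≤ mΩ) {G : Ω → ℝ} (hG : StronglyMeasurable[m] G) (hGi : Integrable G P) {ε : ℝ}
    (h : ∀ A, MeasurableSet[m] A → ∫ ω in A, G ω ∂P ≤ ε * P.real A) : ∀ᵐ ω ∂P, G ω ≤ ε := by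
  refine ae_le_of_ae_le_trim (hm := hmle) (f₂ := fun _ => ε) ?_
  refine ae_le_of_forall_setIntegral_le (hGi.trim hmle hG) (integrable_const ε) fun A hA _ => ?_
  rw [← setIntegral_trim hmle hG hA, setIntegral_const, smul_eq_mul, measureReal_def,
    trim_measurableSet_eq hmle hA, mul_comm]
  exact h A hA

/-- A bound on all averages of `F` over events of `m` bounds its conditional expectation. Real and
imaginary parts are treated separately, which costs the factor `2`. -/
lemma ae_norm_condExp_le [IsFiniteMeasure P] (hmle : m ≤ mΩ)
    {F : Ω → ℂ} (hF : Integrable F P) {ε : ℝ}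
    (h : ∀ A, MeasurableSet[m] A → ‖∫ ω in A, F ω ∂P‖ ≤ ε * P.real A) :
    ∀ᵐ ω ∂P, ‖(P[F | m]) ω‖ ≤ 2 * ε := by
  have hset : ∀ A, MeasurableSet[m] A → ∀ L : ℂ →L[ℝ] ℝ, (∀ z, |L z| ≤ ‖z‖) →
      |∫ ω in A, L ((P[F | m]) ω) ∂P| ≤ ε * P.real A := fun A hA L hL => by
    rw [L.integral_comp_comm integrable_condExp.integrableOn, setIntegral_condExp hmle hF hA]
    exact (hL _).trans (h A hA)
  have hL : ∀ L : ℂ →L[ℝ] ℝ, (∀ z, |L z| ≤ ‖z‖) → ∀ᵐ ω ∂P, |L ((P[F | m]) ω)| ≤ ε := fun L hL => by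
    have hsm : StronglyMeasurable[m] fun ω => L ((P[F | m]) ω) :=
      L.continuous.comp_stronglyMeasurable stronglyMeasurable_condExp
    have hi : Integrable (fun ω => L ((P[F | m]) ω)) P := L.integrable_comp integrable_condExp
    have h1 := ae_le_of_forall_setIntegral_le_mul hmle hsm hi (ε := ε) fun A hA =>
      (le_abs_self _).trans (hset A hA L hL)
    have h2 := ae_le_of_forall_setIntegral_le_mul hmle hsm.neg hi.neg (ε := ε) fun A hA => by
      simp only [Pi.neg_apply]
      rw [integral_neg]
      exact (neg_le_abs _).trans (hset A hA L hL)
    filter_upwards [h1, h2] with ω h1 h2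
    rw [Pi.neg_apply] at h2
    exact abs_le.2 ⟨by linarith, h1⟩
  filter_upwards [hL Complex.reCLM Complex.abs_re_le_norm, hL Complex.imCLM Complex.abs_im_le_norm]
    with ω h1 h2
  refine (Complex.norm_le_abs_re_add_abs_im _).trans ?_
  simp only [Complex.reCLM_apply, Complex.imCLM_apply] at h1 h2
  linarith

end CondLaw

/-! ### Convergence to Gaussian laws -/

section Gaussian

lemma charFun_gaussianReal_zero {w : ℝ} (hw : 0 ≤ w) (t : ℝ) :
    charFun (gaussianReal 0 w.toNNReal) t = (Real.exp (-(t ^ 2 / 2 * w)) : ℂ) := by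
  rw [charFun_gaussianReal, Real.coe_toNNReal w hw]
  push_cast
  congr 1
  ring

/-- Scaling the standard Gaussian law by `√w`. -/
lemma gaussianReal_Icc_mul_sqrt {w : ℝ} (hw : 0 < w) (c : ℝ) :
    (gaussianReal 0 w.toNNReal).real (Set.Icc (-(c * √w)) (c * √w))
      = (gaussianReal 0 1).real (Set.Icc (-c) c) := by
  have hs : 0 < √w := Real.sqrt_pos.2 hw
  have h : gaussianReal 0 w.toNNReal = (gaussianReal 0 1).map (√w * ·) := by
    rw [gaussianReal_map_const_mul, mul_zero, mul_one]
    congr 1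
    ext
    simp [Real.sq_sqrt hw.le, hw.le]
  rw [h, map_measureReal_apply (by fun_prop) measurableSet_Icc]
  congr 1
  ext x
  simp only [Set.mem_preimage, Set.mem_Icc]
  rw [← neg_mul, mul_comm (√w) x, mul_le_mul_iff_left₀ hs, mul_le_mul_iff_left₀ hs]

lemma continuousAt_gaussianReal_Icc {z : ℝ} (hz : 0 < z) :
    ContinuousAt (fun c => (gaussianReal 0 1).real (Set.Icc (-c) c)) z := by
  have hint : ∀ a b, IntervalIntegrable (gaussianPDFReal 0 1) volume a b := fun a b =>
    (integrable_gaussianPDFReal 0 1).intervalIntegrable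
  have hc : Continuous fun c : ℝ => ∫ x in (-c)..c, gaussianPDFReal 0 1 x := by
    have hF := intervalIntegral.continuous_primitive hint 0
    refine (hF.sub (hF.comp continuous_neg)).congr fun c => ?_
    exact intervalIntegral.integral_interval_sub_left (hint _ _) (hint _ _)
  refine hc.continuousAt.congr ?_
  filter_upwards [lt_mem_nhds hz] with c hc0
  rw [measureReal_def, gaussianReal_apply_eq_integral 0 one_ne_zero, ENNReal.toReal_ofReal
    (integral_nonneg fun x => gaussianPDFReal_nonneg 0 1 x),
    intervalIntegral.integral_of_le (by linarith), integral_Icc_eq_integral_Ioc]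

/-- Weak convergence to a nondegenerate centered Gaussian law implies convergence of the
probabilities of symmetric intervals whose half-width is a multiple of a consistent estimate of
the standard deviation. -/
lemma tendsto_real_Icc_of_tendsto_gaussianReal {μ : ℕ → ProbabilityMeasure ℝ} {w : ℝ} (hw : 0 < w)
    (hμ : Tendsto μ atTop (𝓝 ⟨gaussianReal 0 w.toNNReal, inferInstance⟩)) {v : ℕ → ℝ}
    (hv : Tendsto v atTop (𝓝 w)) {z : ℝ} (hz : 0 < z) :
    Tendsto (fun n => (μ n : Measure ℝ).real (Set.Icc (-(z * √(v n))) (z * √(v n)))) atTop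
      (𝓝 ((gaussianReal 0 1).real (Set.Icc (-z) z))) := by
  have hs : 0 < √w := Real.sqrt_pos.2 hw
  have hw' : w.toNNReal ≠ 0 := by simpa using hw
  have := nullSingletonClass_gaussianReal (μ := 0) hw'
  have hfix : ∀ c, Tendsto (fun n => (μ n : Measure ℝ).real (Set.Icc (-(c * √w)) (c * √w))) atTop
      (𝓝 ((gaussianReal 0 1).real (Set.Icc (-c) c))) := fun c => by
    have h := ProbabilityMeasure.tendsto_measure_of_null_frontier_of_tendsto' hμ
      (E := Set.Icc (-(c * √w)) (c * √w)) (by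
        have hsub : frontier (Set.Icc (-(c * √w)) (c * √w)) ⊆ {-(c * √w), c * √w} := by
          rw [isClosed_Icc.frontier_eq, interior_Icc]
          rintro x ⟨⟨h1, h2⟩, h3⟩
          by_contra h4
          simp only [Set.mem_insert_iff, Set.mem_singleton_iff, not_or] at h4
          exact h3 ⟨lt_of_le_of_ne h1 (Ne.symm h4.1), lt_of_le_of_ne h2 h4.2⟩
        change gaussianReal 0 w.toNNReal _ = 0
        exact measure_mono_null hsub (Set.Finite.measure_zero (by simp) _))
    rw [← gaussianReal_Icc_mul_sqrt hw c]
    exact (ENNReal.tendsto_toReal (measure_ne_top _ _)).comp h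
  have hzv : Tendsto (fun n => z * √(v n)) atTop (𝓝 (z * √w)) :=
    ((Real.continuous_sqrt.tendsto w).comp hv).const_mul z
  have hcont := continuousAt_gaussianReal_Icc hz
  refine tendsto_order.2 ⟨fun a ha => ?_, fun a ha => ?_⟩
  · obtain ⟨c, hca, hcz⟩ := ((hcont.eventually (lt_mem_nhds ha)).filter_mono
      nhdsWithin_le_nhds |>.and self_mem_nhdsWithin : ∀ᶠ c in 𝓝[<] z, _ ∧ c < z).exists
    filter_upwards [(tendsto_order.1 (hfix c)).1 a hca,
      (tendsto_order.1 hzv).1 _ (mul_lt_mul_of_pos_right hcz hs)] with n h1 h2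
    exact h1.trans_le (measureReal_mono (Set.Icc_subset_Icc (by linarith) h2.le))
  · obtain ⟨c, hca, hcz⟩ := ((hcont.eventually (gt_mem_nhds ha)).filter_mono
      nhdsWithin_le_nhds |>.and self_mem_nhdsWithin : ∀ᶠ c in 𝓝[>] z, _ ∧ z < c).exists
    filter_upwards [(tendsto_order.1 (hfix c)).2 a hca,
      (tendsto_order.1 hzv).2 _ (mul_lt_mul_of_pos_right hcz hs)] with n h1 h2
    exact (measureReal_mono (Set.Icc_subset_Icc (by linarith) h2.le)).trans_lt h1

end Gaussian

/-! ### The almost sure conditional limit -/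

section CondLimit

variable {Ω : Type*} {m mΩ : MeasurableSpace Ω} {P : Measure Ω}

lemma condExp_exp_sub_ae_eq_charFun_condLaw [IsFiniteMeasure P] (hmle : m ≤ mΩ) {X : Ω → ℝ}
    (hX : Measurable X) {w : Ω → ℝ} (hw : Measurable[m] w) (hw0 : ∀ ω, 0 ≤ w ω) (t : ℝ) :
    P[fun ω => Complex.exp (Complex.I * ((t * X ω : ℝ) : ℂ)) - (Real.exp (-w ω) : ℂ) | m]
      =ᵐ[P] fun ω => charFun (condLaw m P X ω) t - (Real.exp (-w ω) : ℂ) := by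
  have hexp : Measurable fun x : ℝ => Complex.exp (Complex.I * ((t * x : ℝ) : ℂ)) := by fun_prop
  have hneg : Measurable fun x : ℝ => (Real.exp (-x) : ℂ) := by fun_prop
  have hf := (hexp.comp (@measurable_snd Ω ℝ m _)).sub
    ((hneg.comp hw).comp (@measurable_fst Ω ℝ m _))
  have hint : Integrable (fun ω => Complex.exp (Complex.I * ((t * X ω : ℝ) : ℂ))
      - (Real.exp (-w ω) : ℂ)) P := by
    refine integrable_of_measurable_of_bound
      ((hexp.comp hX).sub (hneg.comp (hw.mono hmle le_rfl))) 2 fun ω => ?_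
    refine (norm_sub_le _ _).trans ?_
    rw [LearningModel.norm_cexp_I_mul]
    linarith [LearningModel.norm_ofReal_exp_neg_le_one (hw0 ω)]
  refine (condExp_ae_eq_integral_condLaw hmle hX hf.stronglyMeasurable hint).trans
    (Eventually.of_forall fun ω => ?_)
  have := isProbabilityMeasure_condLaw m P X ω
  have hi : Integrable (fun x : ℝ => Complex.exp (Complex.I * ((t * x : ℝ) : ℂ)))
      (condLaw m P X ω) :=
    integrable_of_measurable_of_bound hexp 1 fun x => (LearningModel.norm_cexp_I_mul _).le
  simp only [Pi.sub_apply, Function.comp_apply]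
  rw [integral_sub hi (integrable_const _), integral_const, probReal_univ, one_smul,
    charFun_apply_real]
  congr 2
  funext x
  push_cast
  rw [mul_comm]

/-- The half-width `r` may depend on the past. -/
lemma condProb_abs_le_ae_eq [IsFiniteMeasure P] (hmle : m ≤ mΩ) {X : Ω → ℝ} (hX : Measurable X)
    {r : Ω → ℝ} (hr : Measurable[m] r) :
    P⟦{ω | |X ω| ≤ r ω} | m⟧
      =ᵐ[P] fun ω => (condLaw m P X ω).real (Set.Icc (-r ω) (r ω)) := by
  have hS : MeasurableSet[@Prod.instMeasurableSpace Ω ℝ m _] {p : Ω × ℝ | |p.2| ≤ r p.1} := by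
    have h1 := (measurable_norm (α := ℝ)).comp (@measurable_snd Ω ℝ m Real.measurableSpace)
    have h2 := hr.comp (@measurable_fst Ω ℝ m Real.measurableSpace)
    exact measurableSet_le h1 h2
  have hf : StronglyMeasurable[@Prod.instMeasurableSpace Ω ℝ m _]
      ({p : Ω × ℝ | |p.2| ≤ r p.1}.indicator fun _ => (1 : ℝ)) :=
    (measurable_const.indicator hS).stronglyMeasurable
  have hset : MeasurableSet {ω | |X ω| ≤ r ω} :=
    measurableSet_le (measurable_norm.comp hX) (hr.mono hmle le_rfl)
  have hint : Integrable (fun ω => {p : Ω × ℝ | |p.2| ≤ r p.1}.indicator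
      (fun _ => (1 : ℝ)) (ω, X ω)) P := (integrable_const (1 : ℝ)).indicator hset
  refine (condExp_ae_eq_integral_condLaw hmle hX hf hint).trans (Eventually.of_forall fun ω => ?_)
  have e : (fun x => {p : Ω × ℝ | |p.2| ≤ r p.1}.indicator (fun _ => (1 : ℝ)) (ω, x))
      = (Set.Icc (-r ω) (r ω)).indicator 1 := by
    funext x
    by_cases h : |x| ≤ r ω
    · rw [Set.indicator_of_mem (by exact h), Set.indicator_of_mem (by exact abs_le.1 h),
        Pi.one_apply]
    · rw [Set.indicator_of_notMem (by exact h),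
        Set.indicator_of_notMem (show x ∉ Set.Icc (-r ω) (r ω) from fun h' => h (abs_le.2 h'))]
  simp only [e]
  exact integral_indicator_one measurableSet_Icc

end CondLimit

namespace LearningModel

variable {Ω : Type*} [mΩ : MeasurableSpace Ω] {P : Measure Ω} {d : ℕ} {ϑ : Fin d → ℝ}
  {α : ℕ → ℝ} {g₀ : Fin d → ℝ} {Y : ℕ → Ω → ℕ}

/-- Consistency of the plug-in variance. -/
lemma ae_tendsto_asympVar (hm : LearningModel P ϑ α g₀ Y) {gt : Ω → Fin d → ℝ}
    (hgt : IsRandomLimit P (newtonProcess ϑ α g₀ Y) gt) (y : ℕ) :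
    ∀ᵐ ω ∂P, Tendsto (fun n => asympVar ϑ (newtonProcess ϑ α g₀ Y n ω) y) atTop
      (𝓝 (asympVar ϑ (gt ω) y)) := by
  filter_upwards [hgt.tendsto] with ω hω
  exact (continuousOn_asympVar hm.grid_pos y (gt ω) (hgt.mem_simplex ω)).tendsto.comp
    (tendsto_nhdsWithin_iff.2 ⟨hω, Eventually.of_forall fun n => hm.newtonProcess_mem n ω⟩)

/-- The almost sure conditional central limit theorem for the scaled estimation error. -/
lemma ae_tendsto_condLaw [IsProbabilityMeasure P] (hm : LearningModel P ϑ α g₀ Y)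
    (hmono : AntitoneOn α (Set.Ici 1))
    (hsum : Summable fun n : ℕ => (α (n + 1) ^ 2 / tailSq α (n + 1)) ^ 2) {gt : Ω → Fin d → ℝ}
    (hgt : IsRandomLimit P (newtonProcess ϑ α g₀ Y) gt) (y : ℕ) :
    ∀ᵐ ω ∂P, Tendsto (β := ProbabilityMeasure ℝ)
      (fun n => ⟨condLaw (observed Y n) P (fun ω => √(rate α n) * (estimate ϑ (gt ω) y
          - estimate ϑ (newtonProcess ϑ α g₀ Y n ω) y)) ω, isProbabilityMeasure_condLaw _ P _ ω⟩)
      atTop (𝓝 ⟨gaussianReal 0 (asympVar ϑ (gt ω) y).toNNReal, inferInstance⟩) := by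
  obtain ⟨ε, hεc, hε0, hε⟩ := hm.exists_charFun_error hmono hsum hgt y
  set X : ℕ → Ω → ℝ := fun n ω => √(rate α n) * (estimate ϑ (gt ω) y
    - estimate ϑ (newtonProcess ϑ α g₀ Y n ω) y) with hX
  set W : ℕ → Ω → ℝ := fun n ω => asympVar ϑ (newtonProcess ϑ α g₀ Y n ω) y with hW
  have hW0 : ∀ n ω, 0 ≤ W n ω := fun n ω =>
    asympVar_nonneg hm.grid_pos (hm.newtonProcess_mem n ω) y
  have hWm : ∀ n, Measurable[observed Y n] (W n) := fun n =>
    measurable_comp_newtonProcess (fun _ g => asympVar ϑ g y) (le_refl n)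
  have hXm : ∀ n, Measurable (X n) := fun n => hm.measurable_scaled_error hgt y n
  -- only countably many exceptional null sets are allowed, so the bound is first obtained at
  -- rational frequencies; it extends to all of them since both sides are continuous
  have hrat : ∀ᵐ ω ∂P, ∀ n, 1 ≤ n → ∀ q : ℚ, ‖charFun (condLaw (observed Y n) P (X n) ω) q
      - (Real.exp (-((q : ℝ) ^ 2 / 2 * W n ω)) : ℂ)‖ ≤ 2 * ε n q := by
    refine ae_all_iff.2 fun n => ?_
    by_cases hn : 1 ≤ n
    · have hle := observed_le hm.measurable n
      have hq : ∀ q : ℚ, ∀ᵐ ω ∂P, ‖charFun (condLaw (observed Y n) P (X n) ω) q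
          - (Real.exp (-((q : ℝ) ^ 2 / 2 * W n ω)) : ℂ)‖ ≤ 2 * ε n q := fun q => by
        have hwm : Measurable[observed Y n] fun ω => (q : ℝ) ^ 2 / 2 * W n ω :=
          (hWm n).const_mul _
        have hw0 : ∀ ω, 0 ≤ (q : ℝ) ^ 2 / 2 * W n ω := fun ω =>
          mul_nonneg (by positivity) (hW0 n ω)
        have hint : Integrable (fun ω => Complex.exp (Complex.I * (((q : ℝ) * X n ω : ℝ) : ℂ))
            - (Real.exp (-((q : ℝ) ^ 2 / 2 * W n ω)) : ℂ)) P := by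
          have h1 := hXm n
          have h2 := (hWm n).mono hle le_rfl
          refine integrable_of_measurable_of_bound (by fun_prop) 2 fun ω => ?_
          refine (norm_sub_le _ _).trans ?_
          rw [norm_cexp_I_mul]
          linarith [norm_ofReal_exp_neg_le_one (hw0 ω)]
        filter_upwards [ae_norm_condExp_le hle hint fun A hA => hε n hn A hA q,
          condExp_exp_sub_ae_eq_charFun_condLaw hle (hXm n) hwm hw0 (q : ℝ)] with ω h1 h2
        rwa [← h2]
      filter_upwards [ae_all_iff.2 hq] with ω h _
      exact h
    · exact Eventually.of_forall fun ω h => absurd h hn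
  filter_upwards [hrat, hm.ae_tendsto_asympVar hgt y] with ω hω hWω
  refine ProbabilityMeasure.tendsto_of_tendsto_charFun fun t => ?_
  have hreal : ∀ n, 1 ≤ n → ‖charFun (condLaw (observed Y n) P (X n) ω) t
      - (Real.exp (-(t ^ 2 / 2 * W n ω)) : ℂ)‖ ≤ 2 * ε n t := fun n hn => by
    have := isProbabilityMeasure_condLaw (observed Y n) P (X n) ω
    refine isClosed_property (Rat.denseRange_cast (𝕜 := ℝ)) (p := fun t : ℝ =>
      ‖charFun (condLaw (observed Y n) P (X n) ω) t - (Real.exp (-(t ^ 2 / 2 * W n ω)) : ℂ)‖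
        ≤ 2 * ε n t) (isClosed_le ?_ ((hεc n).const_mul 2)) (hω n hn) t
    have h1 : Continuous (charFun (condLaw (observed Y n) P (X n) ω)) := continuous_charFun
    fun_prop
  have hlim : Tendsto (fun n => (Real.exp (-(t ^ 2 / 2 * W n ω)) : ℂ)) atTop
      (𝓝 (Real.exp (-(t ^ 2 / 2 * asympVar ϑ (gt ω) y)) : ℂ)) :=
    (Complex.continuous_ofReal.tendsto _).comp ((Real.continuous_exp.tendsto _).comp
      (hWω.const_mul _).neg)
  have hdiff : Tendsto (fun n => charFun (condLaw (observed Y n) P (X n) ω) t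
      - (Real.exp (-(t ^ 2 / 2 * W n ω)) : ℂ)) atTop (𝓝 0) := by
    refine squeeze_zero_norm' ((eventually_ge_atTop 1).mono fun n hn => hreal n hn) ?_
    simpa using (hε0 t).const_mul 2
  change Tendsto (fun n => charFun (condLaw (observed Y n) P (X n) ω) t) atTop
    (𝓝 (charFun (gaussianReal 0 (asympVar ϑ (gt ω) y).toNNReal) t))
  rw [charFun_gaussianReal_zero (asympVar_nonneg hm.grid_pos (hgt.mem_simplex ω) y)]
  simpa using hdiff.add hlim

/-- The asymptotic level of the credible intervals. -/
lemma ae_tendsto_credible [IsProbabilityMeasure P] (hm : LearningModel P ϑ α g₀ Y)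
    (hmono : AntitoneOn α (Set.Ici 1))
    (hsum : Summable fun n : ℕ => (α (n + 1) ^ 2 / tailSq α (n + 1)) ^ 2) {gt : Ω → Fin d → ℝ}
    (hgt : IsRandomLimit P (newtonProcess ϑ α g₀ Y) gt) (y : ℕ) {z : ℝ} (hz : 0 < z) :
    ∀ᵐ ω ∂P, 0 < asympVar ϑ (gt ω) y →
      Tendsto (fun n => (P⟦{ω' | |estimate ϑ (gt ω') y - estimate ϑ (newtonProcess ϑ α g₀ Y n ω') y|
          ≤ z * √(asympVar ϑ (newtonProcess ϑ α g₀ Y n ω') y / rate α n)} | observed Y n⟧) ω)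
        atTop (𝓝 ((gaussianReal 0 1).real (Set.Icc (-z) z))) := by
  have hcond : ∀ᵐ ω ∂P, ∀ n, 1 ≤ n →
      (P⟦{ω' | |estimate ϑ (gt ω') y - estimate ϑ (newtonProcess ϑ α g₀ Y n ω') y|
          ≤ z * √(asympVar ϑ (newtonProcess ϑ α g₀ Y n ω') y / rate α n)} | observed Y n⟧) ω
        = (condLaw (observed Y n) P (fun ω => √(rate α n) * (estimate ϑ (gt ω) y
          - estimate ϑ (newtonProcess ϑ α g₀ Y n ω) y)) ω).real
          (Set.Icc (-(z * √(asympVar ϑ (newtonProcess ϑ α g₀ Y n ω) y)))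
            (z * √(asympVar ϑ (newtonProcess ϑ α g₀ Y n ω) y))) := by
    refine ae_all_iff.2 fun n => ?_
    by_cases hn : 1 ≤ n
    · have hb : 0 < √(rate α n) := Real.sqrt_pos.2 (hm.rate_pos hn)
      have hset : {ω' | |estimate ϑ (gt ω') y - estimate ϑ (newtonProcess ϑ α g₀ Y n ω') y|
            ≤ z * √(asympVar ϑ (newtonProcess ϑ α g₀ Y n ω') y / rate α n)}
          = {ω' | |√(rate α n) * (estimate ϑ (gt ω') y
            - estimate ϑ (newtonProcess ϑ α g₀ Y n ω') y)|
            ≤ z * √(asympVar ϑ (newtonProcess ϑ α g₀ Y n ω') y)} := by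
        ext ω'
        simp only [Set.mem_ofPred_eq]
        rw [Real.sqrt_div (asympVar_nonneg hm.grid_pos (hm.newtonProcess_mem n ω') y), abs_mul,
          abs_of_pos hb, ← mul_div_assoc, le_div_iff₀ hb, mul_comm]
      rw [hset]
      have hr : Measurable[observed Y n] fun ω =>
          z * √(asympVar ϑ (newtonProcess ϑ α g₀ Y n ω) y) :=
        measurable_comp_newtonProcess (fun _ g => z * √(asympVar ϑ g y)) (le_refl n)
      filter_upwards [condProb_abs_le_ae_eq (observed_le hm.measurable n)
        (hm.measurable_scaled_error hgt y n) hr] with ω h _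
      exact h
    · exact Eventually.of_forall fun ω h => absurd h hn
  filter_upwards [hcond, hm.ae_tendsto_condLaw hmono hsum hgt y, hm.ae_tendsto_asympVar hgt y]
    with ω h1 h2 h3 hpos
  refine (tendsto_real_Icc_of_tendsto_gaussianReal hpos h2 h3 hz).congr' ?_
  filter_upwards [eventually_ge_atTop 1] with n hn
  exact (h1 n hn).symm

end LearningModel

end QuasiBayes

theorem theorem2 {Ω : Type*} [MeasurableSpace Ω] (P : Measure Ω) [IsProbabilityMeasure P]
    {d : ℕ} (ϑ : Fin d → ℝ) (α : ℕ → ℝ) (g₀ : Fin d → ℝ) (Y : ℕ → Ω → ℕ)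
    (hmodel : LearningModel P ϑ α g₀ Y)
    (hmono : AntitoneOn α (Set.Ici 1))
    (hsum : Summable fun n : ℕ => (α (n + 1) ^ 2 / tailSq α (n + 1)) ^ 2) :
    (∃ gt : Ω → Fin d → ℝ, IsRandomLimit P (newtonProcess ϑ α g₀ Y) gt) ∧
    ∀ gt : Ω → Fin d → ℝ, IsRandomLimit P (newtonProcess ϑ α g₀ Y) gt → ∀ y : ℕ,
      -- the almost sure conditional central limit theorem
      (∃ (κ : Kernel Ω ℝ) (_ : IsMarkovKernel κ),
        IsCenteredGaussianKernel κ (fun ω => asympVar ϑ (gt ω) y) ∧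
        ConvergesCondAS P (observed Y)
          (fun n ω => Real.sqrt (rate α n) *
            (estimate ϑ (gt ω) y - estimate ϑ (newtonProcess ϑ α g₀ Y n ω) y)) κ) ∧
      -- consistency of the plug-in variance
      (∀ᵐ ω ∂P, Tendsto (fun n => asympVar ϑ (newtonProcess ϑ α g₀ Y n ω) y) atTop
        (𝓝 (asympVar ϑ (gt ω) y))) ∧
      -- the asymptotic credible intervals
      (∀ z : ℝ, 0 < z → ∀ᵐ ω ∂P, 0 < asympVar ϑ (gt ω) y →
        Tendsto
          (fun n => (P⟦{ω' | |estimate ϑ (gt ω') y - estimate ϑ (newtonProcess ϑ α g₀ Y n ω') y|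
              ≤ z * Real.sqrt (asympVar ϑ (newtonProcess ϑ α g₀ Y n ω') y / rate α n)}
            | observed Y n⟧) ω)
          atTop (𝓝 ((gaussianReal 0 1).real (Set.Icc (-z) z)))) := by
  refine ⟨hmodel.exists_isRandomLimit, fun gt hgt y => ⟨?_, hmodel.ae_tendsto_asympVar hgt y,
    fun z hz => hmodel.ae_tendsto_credible hmono hsum hgt y hz⟩⟩
  have hW : Measurable fun ω => asympVar ϑ (gt ω) y :=
    LearningModel.measurable_comp_limit (continuousOn_asympVar hmodel.grid_pos y) hgt
  let κ : Kernel Ω ℝ :=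
    ⟨fun ω => gaussianReal 0 (asympVar ϑ (gt ω) y).toNNReal,
      measurable_gaussianReal.comp (measurable_const.prodMk hW.real_toNNReal)⟩
  have hκ : IsMarkovKernel κ := ⟨fun ω => instIsProbabilityMeasureGaussianReal _ _⟩
  exact ⟨κ, hκ, ⟨hW, fun ω => ⟨asympVar_nonneg hmodel.grid_pos (hgt.mem_simplex ω) y, rfl⟩⟩,
    hmodel.ae_tendsto_condLaw hmono hsum hgt y⟩
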